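/- Let $n\ge 2$. Let $J^k=J^k(\mathbb R,\mathbb R)$ have coordinates $(x,y_0,\dots,y_k)$, contact forms $\theta_i=dy_i-y_{i+1}\,dx$ and projections $\pi_{m,k}\colon J^m\to J^k$, and let $D=\partial_x+\sum_i y_{i+1}\partial_{y_i}$ be the total derivative. A (nondegenerate) Lagrangian of order $n$ is a form $L=f(x,y_0,\dots,y_n)\,dx$ with $f$ smooth on an open set $U\subseteq J^n$ and $\partial^2 f/\partial y_n^2\neq0$ on $U$. Its Euler--Lagrange equation is $$\mathcal E(L)=\Big\{p\in J^{2n} : \pi_{2n,n}(p)\in U,\ \sum_{i=0}^n(-1)^iD^i\Big(\frac{\partial f}{\partial y_i}\Big)(p)=0\Big\}.$$ A contact transformation is a smooth diffeomorphism $\varphi=(X,Y_0,Y_1)$ between open subsets of $J^1$ that preserves $\theta_0$ up to a nowhere vanishing factor; its prolongation $\Phi^k=(X,Y_0,\dots,Y_k)$, where $Y_{i+1}=DY_i/DX$ for $i\ge1$, is defined on the jets in $J^k$ ($k\ge2$) lying over the domain of $\varphi$ at which $DX\ne0$. Let $L_1,L_2$ be Lagrangians of order $n$. * For $k\ge n$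 and $b_1,b_2\in J^k$, $L_1$ and $L_2$ are called equivalent near $(b_1,b_2)$ if there are a contact transformation $\varphi$ whose prolongation is defined near $b_1$ and satisfies $\Phi^k(b_1)=b_2$, a constant $\alpha\in\mathbb R\setminus\{0\}$, and a smooth function $\mu$ of jets of some finite order, defined over a neighbourhood of $b_1$ in $J^k$, such that over this neighbourhood (on which both sides are defined) $$\Phi^*L_2=\alpha L_1+(D\mu)\,dx \mod \langle\theta_i\mid i\ge0\rangle .$$ * For $b_1,b_2\in J^{2n}$, $\mathcal E(L_1)$ and $\mathcal E(L_2)$ are called contact equivalent near $(b_1,b_2)$ if there are a contact transformation $\varphi$ and an open neighbourhood $V$ of $b_1$ in $J^{2n}$ on which $\Phi^{2n}$ is defined, with $\Phi^{2n}(b_1)=b_2$ and $\Phi^{2n}(\mathcal E(L_1)\cap V)=\mathcal E(L_2)\cap\Phi^{2n}(V)$. Then Lagrangians are locally equivalent if and only if their Euler--Lagrange equations are locally contact equivalent: 1. For all $a_1,a_2\in J^n$, $L_1$ and $L_2$ are equivalent near $(a_1,a_2)$ if and only if there are $b_1\in\mathcal E(L_1)$ and $b_2\in\mathcal E(L_2)$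 with $\pi_{2n,n}(b_i)=a_i$ such that $\mathcal E(L_1)$ and $\mathcal E(L_2)$ are contact equivalent near $(b_1,b_2)$. 2. For all $b_1\in\mathcal E(L_1)$ and $b_2\in J^{2n}$, $L_1$ and $L_2$ are equivalent near $(b_1,b_2)$ if and only if $\mathcal E(L_1)$ and $\mathcal E(L_2)$ are contact equivalent near $(b_1,b_2)$. -/

import Mathlib

open scoped ContDiff Topology

noncomputable section

namespace VarJet

/-! ### Jet spaces of functions of one variable -/

/-- The jet space `J^k(ℝ, ℝ)` with its standard coordinates `(x, (y_0, …, y_k))`. -/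
abbrev Jet (k : ℕ) : Type := ℝ × (Fin (k + 1) → ℝ)

/-- The projection `π_{m,k} : J^m → J^k` for `k ≤ m`. -/
def proj {k m : ℕ} (h : k ≤ m) (p : Jet m) : Jet k :=
  (p.1, fun i => p.2 (Fin.castLE (Nat.add_le_add_right h 1) i))

/-- The total derivative `D F = F_x + ∑_{i ≤ k} y_{i+1} F_{y_i}` of a function on `J^k`, which is a
function on `J^{k+1}`. -/
def totalDeriv {k : ℕ} (F : Jet k → ℝ) (p : Jet (k + 1)) : ℝ :=
  fderiv ℝ F (proj (Nat.le_succ k) p) (1, fun i => p.2 i.succ)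

/-- The iterated total derivative `D^i F`, a function on `J^{k+i}`. -/
def iterTotalDeriv {k : ℕ} (F : Jet k → ℝ) : (i : ℕ) → Jet (k + i) → ℝ
  | 0 => F
  | i + 1 => totalDeriv (iterTotalDeriv F i)

/-- The partial derivative `∂F/∂y_i` of a function on `J^k`. -/
def partialY {k : ℕ} (F : Jet k → ℝ) (i : Fin (k + 1)) (p : Jet k) : ℝ :=
  fderiv ℝ F p (0, Pi.single i 1)

/-! ### Differential one-forms on jet spaces -/

/-- The coordinate form `dx`. -/
def dx (k : ℕ) : Jet k →L[ℝ] ℝ := ContinuousLinearMap.fst ℝ ℝ (Fin (k + 1) → ℝ)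

/-- The coordinate form `dy_i`. -/
def dy (k : ℕ) (i : Fin (k + 1)) : Jet k →L[ℝ] ℝ :=
  (ContinuousLinearMap.proj (R := ℝ) (φ := fun _ : Fin (k + 1) => ℝ) i).comp
    (ContinuousLinearMap.snd ℝ ℝ (Fin (k + 1) → ℝ))

/-- The contact forms `θ_i = dy_i - y_{i+1} dx`, `0 ≤ i < k`, on `J^k`. -/
def contactForm (k : ℕ) (i : Fin k) (p : Jet k) : Jet k →L[ℝ] ℝ :=
  dy k i.castSucc - p.2 i.succ • dx k

/-- The pull-back `Φ^* β` of a one-form. -/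
def pullback {k : ℕ} (Φ : Jet k → Jet k) (β : Jet k → (Jet k →L[ℝ] ℝ)) (p : Jet k) :
    Jet k →L[ℝ] ℝ :=
  (β (Φ p)).comp (fderiv ℝ Φ p)

/-- The horizontal differential `d_H μ = (D μ) dx` of a function on `J^k`. -/
def dH {k : ℕ} (μ : Jet k → ℝ) (p : Jet (k + 1)) : Jet (k + 1) →L[ℝ] ℝ :=
  totalDeriv μ p • dx (k + 1)

/-- The value at `p` of a one-form lies in the span of the contact forms. -/
def InContactSpan {k : ℕ} (p : Jet k) (β : Jet k →L[ℝ] ℝ) : Prop :=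
  β ∈ Submodule.span ℝ (Set.range fun i : Fin k => contactForm k i p)

/-! ### Contact transformations and their prolongations -/

/-- A (local) contact transformation of `J^1`: a smooth diffeomorphism between two open subsets of
`J^1` which preserves the contact form `θ_0 = dy_0 - y_1 dx` up to a nonvanishing factor. -/
structure ContactTransformation where
  toMap : OpenPartialHomeomorph (Jet 1) (Jet 1)
  smooth : ContDiffOn ℝ ∞ toMap toMap.source
  smooth_symm : ContDiffOn ℝ ∞ toMap.symm toMap.target
  contact : ∀ p ∈ toMap.source, ∃ c : ℝ, c ≠ 0 ∧
    pullback toMap (contactForm 1 0) p = c • contactForm 1 0 p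

namespace ContactTransformation

/-- The component `X` of `φ = (X, Y_0, Y_1)`. -/
def X (φ : ContactTransformation) (p : Jet 1) : ℝ := (φ.toMap p).1

/-- `φ.prolongY i` is the component `Y_{i+1}` of the prolongation of `φ = (X, Y_0, Y_1)`:
it is the given `Y_1` for `i = 0`, and `Y_{j+1} = D Y_j / D X` for `j ≥ 1`. -/
def prolongY (φ : ContactTransformation) : (i : ℕ) → Jet (i + 1) → ℝ
  | 0 => fun p => (φ.toMap p).2 1
  | i + 1 => fun p =>
      totalDeriv (φ.prolongY i) p / totalDeriv φ.X (proj (by omega : 1 + 1 ≤ i + 1 + 1) p)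

/-- The prolongation `Φ^k : J^k → J^k`, `k ≥ 1`, of a contact transformation. It is to be used on
`φ.prolongDomain` only. -/
def prolong (φ : ContactTransformation) {k : ℕ} (hk : 1 ≤ k) (p : Jet k) : Jet k :=
  (φ.X (proj hk p), fun i =>
    if h : (i : ℕ) = 0 then (φ.toMap (proj hk p)).2 0
    else φ.prolongY (i - 1) (proj (by omega : (i : ℕ) - 1 + 1 ≤ k) p))

/-- The open subset of `J^k`, `k ≥ 2`, on which the prolongation of `φ` is defined: the jets over
the domain of `φ` at which `D X ≠ 0`, that is, whose images are again jets of functions. -/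
def prolongDomain (φ : ContactTransformation) {k : ℕ} (hk : 2 ≤ k) : Set (Jet k) :=
  {p | proj (by omega : 1 ≤ k) p ∈ φ.toMap.source ∧
    totalDeriv φ.X (proj (by omega : 1 + 1 ≤ k) p) ≠ 0}

end ContactTransformation

/-! ### Lagrangians and Euler–Lagrange equations -/

/-- A nondegenerate Lagrangian `f(x, y, y', …, y^{(n)}) dx` of order `n`: a smooth function `f` on
an open subset of `J^n` whose second derivative in `y_n` does not vanish. -/
structure Lagrangian (n : ℕ) where
  dom : Set (Jet n)
  isOpen_dom : IsOpen dom
  f : Jet n → ℝ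
  smooth : ContDiffOn ℝ ∞ f dom
  nondegenerate : ∀ p ∈ dom, partialY (partialY f (Fin.last n)) (Fin.last n) p ≠ 0

namespace Lagrangian

variable {n : ℕ}

/-- The Lagrangian as a one-form `f dx` on `J^m`, `m ≥ n`. -/
def form (L : Lagrangian n) {m : ℕ} (h : n ≤ m) (p : Jet m) : Jet m →L[ℝ] ℝ :=
  L.f (proj h p) • dx m

/-- The Euler–Lagrange expression `∑_{i=0}^n (-1)^i D^i (∂f/∂y_i)` on `J^{2n}`. -/
def eulerLagrange (L : Lagrangian n) (p : Jet (2 * n)) : ℝ :=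
  ∑ i : Fin (n + 1), (-1) ^ (i : ℕ) *
    iterTotalDeriv (partialY L.f i) i (proj (by omega : n + (i : ℕ) ≤ 2 * n) p)

/-- The Euler–Lagrange equation `ℰ(L) ⊆ J^{2n}`. -/
def equation (L : Lagrangian n) : Set (Jet (2 * n)) :=
  {p | proj (by omega : n ≤ 2 * n) p ∈ L.dom ∧ L.eulerLagrange p = 0}

end Lagrangian

/-! ### The two equivalence relations -/

/-- Equivalence of the Lagrangians `L₁`, `L₂` of order `n` near the jets `b₁, b₂ ∈ J^k`,
`k ≥ n`: there are a contact transformation `φ` whose prolongation maps `b₁` to `b₂`, a constant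
`α ≠ 0` and a smooth function `μ` of jets of some finite order `m`, defined over a neighbourhood
`V` of `b₁`, with `Φ^* L₂ = α L₁ + d_H μ` modulo the contact forms. -/
def LagrangianEquivAt {n k : ℕ} (hn : 2 ≤ n) (hk : n ≤ k) (L₁ L₂ : Lagrangian n)
    (b₁ b₂ : Jet k) : Prop :=
  ∃ (φ : ContactTransformation) (V : Set (Jet k)),
    IsOpen V ∧ b₁ ∈ V ∧ V ⊆ φ.prolongDomain (by omega : 2 ≤ k) ∧
    (∀ p ∈ V, proj hk p ∈ L₁.dom ∧ proj hk (φ.prolong (by omega : 1 ≤ k) p) ∈ L₂.dom) ∧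
    φ.prolong (by omega : 1 ≤ k) b₁ = b₂ ∧
    ∃ α : ℝ, α ≠ 0 ∧ ∃ (m : ℕ) (hm : k ≤ m) (μ : Jet m → ℝ),
      ContDiffOn ℝ ∞ μ {q | proj hm q ∈ V} ∧
      ∀ q : Jet (m + 1), proj (by omega : k ≤ m + 1) q ∈ V →
        InContactSpan q
          (pullback (φ.prolong (by omega : 1 ≤ m + 1)) (L₂.form (by omega : n ≤ m + 1)) q
            - (α • L₁.form (by omega : n ≤ m + 1) q + dH μ q))

/-- Contact equivalence of the Euler–Lagrange equations `ℰ(L₁)`, `ℰ(L₂)` near the points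
`b₁, b₂ ∈ J^{2n}`: the prolongation to `J^{2n}` of some contact transformation maps `b₁` to `b₂`
and, near `b₁`, maps `ℰ(L₁)` onto `ℰ(L₂)`. -/
def EulerLagrangeEquivAt {n : ℕ} (hn : 2 ≤ n) (L₁ L₂ : Lagrangian n)
    (b₁ b₂ : Jet (2 * n)) : Prop :=
  ∃ (φ : ContactTransformation) (V : Set (Jet (2 * n))),
    IsOpen V ∧ b₁ ∈ V ∧ V ⊆ φ.prolongDomain (by omega : 2 ≤ 2 * n) ∧
    φ.prolong (by omega : 1 ≤ 2 * n) b₁ = b₂ ∧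
    φ.prolong (by omega : 1 ≤ 2 * n) '' (L₁.equation ∩ V) =
      L₂.equation ∩ φ.prolong (by omega : 1 ≤ 2 * n) '' V

end VarJet

end

/-! Modulo contact forms a contact transformation turns `f₂ dx` into `f₂(Φ) DX dx`, so equivalence
of Lagrangians means `f₂(Φ) DX = α f₁ + Dμ` (`inContactSpan_pullback_iff`). Let `E` be the
Euler–Lagrange operator. It kills total derivatives, and `E(f₂(Φ) DX) = DX · c · E(f₂)∘Φ`, where `DX
· c` has no zeros (`euler_pull`). Hence equivalent Lagrangians have equivalent equations.

Conversely, put `F = f₁` and `G = f₂(Φ) DX`; both have order `n`, and `E(G)` vanishes on the zeros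
of `E(F)`. Write `F_nn`, `G_nn` for the second derivatives in `y_n`. Both expressions are affine in
`y_{2n}`, with leading coefficients `(-1)^n F_nn` and `(-1)^n G_nn`. For `l = G_nn / F_nn` the
difference `E(G) - l E(F)` is independent of `y_{2n}`, and a point near `b₁` can be moved in the
direction `y_{2n}` to a zero of `E(F)`. So `E(G) = l E(F)` near `b₁` (`exists_multiplier`).

The decisive fact is that `l` is constant. The derivative of `E(F)` in `y_{2n-1}` is `(-1)^n n
D(F_nn)`, and `l` has order `n < 2n - 1`; hence `D(G_nn) = l D(F_nn)`. As `G_nn = l F_nn`, this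
forces `Dl = 0` (`D_multiplier_eq_zero`), so that `l` is locally a constant `α`. Then `E(G - αF) =
0`, and a Lagrangian with vanishing Euler–Lagrange expression is a total derivative, because its
momenta are the `y`-derivatives of a potential (`exists_D_eq_of_euler_eq_zero`).

The computations take place in the ring of smooth functions on an open subset of one fixed `J^N`,
with the term `y_{N+1} ∂_N` of `D` dropped. This truncation keeps the commutation relations exact
and agrees with the true `D` on functions of order less than `N`. Much of the argument thereby
becomes algebra of derivations (`JetCalc`). -/

open TopologicalSpace

noncomputable section

namespace VarJet

/-! ### The algebra of total and partial derivatives -/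

/-- Derivations `D`, `∂_0, …, ∂_N` of a commutative ring with the commutation relations of the
total derivative and the partial derivatives `∂/∂y_i` on a jet space `J^N`. -/
structure JetCalc (R : Type*) [CommRing R] [Algebra ℝ R] (N : ℕ) where
  D : Derivation ℝ R R
  d : ℕ → Derivation ℝ R R
  d_zero_D : ∀ a, d 0 (D a) = D (d 0 a)
  d_succ_D : ∀ i < N, ∀ a, d (i + 1) (D a) = D (d (i + 1) a) + d i a
  d_comm : ∀ i j a, d i (d j a) = d j (d i a)

namespace JetCalc

variable {R : Type*} [CommRing R] [Algebra ℝ R] {N : ℕ} (C : JetCalc R N)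

/-- The alternating sum `∑_{i < M} (-D)^i a_i`. -/
def altSum (M : ℕ) (a : ℕ → R) : R := ∑ i ∈ Finset.range M, (-1) ^ i * C.D^[i] (a i)

/-- The Euler–Lagrange operator `∑_{i ≤ N} (-D)^i ∂_i`. -/
def euler (F : R) : R := C.altSum (N + 1) fun i => C.d i F

/-- The coefficients of the operator `D ∘ ∑ a_i D^i`. -/
def compD (a : ℕ → R) : ℕ → R
  | 0 => C.D (a 0)
  | i + 1 => C.D (a (i + 1)) + a i

lemma D_neg_one_pow_mul (i : ℕ) (a : R) : C.D ((-1) ^ i * a) = (-1) ^ i * C.D a := by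
  rcases neg_one_pow_eq_or R i with h | h <;> simp [h]

lemma d_neg_one_pow_mul (j i : ℕ) (a : R) : C.d j ((-1) ^ i * a) = (-1) ^ i * C.d j a := by
  rcases neg_one_pow_eq_or R i with h | h <;> simp [h]

lemma iterate_D_add (i : ℕ) (a b : R) : C.D^[i] (a + b) = C.D^[i] a + C.D^[i] b := by
  induction i generalizing a b with
  | zero => rfl
  | succ i ih => simp only [Function.iterate_succ_apply, map_add, ih]

lemma iterate_D_sub (i : ℕ) (a b : R) : C.D^[i] (a - b) = C.D^[i] a - C.D^[i] b := by
  induction i generalizing a b with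
  | zero => rfl
  | succ i ih => simp only [Function.iterate_succ_apply, map_sub, ih]

lemma iterate_D_zero (i : ℕ) : C.D^[i] 0 = 0 := by
  induction i with
  | zero => rfl
  | succ i ih => simp only [Function.iterate_succ_apply, map_zero, ih]

lemma iterate_D_smul (i : ℕ) (r : ℝ) (a : R) : C.D^[i] (r • a) = r • C.D^[i] a := by
  induction i generalizing a with
  | zero => rfl
  | succ i ih => simp only [Function.iterate_succ_apply, Derivation.map_smul, ih]

lemma altSum_add (M : ℕ) (a b : ℕ → R) :
    C.altSum M (fun i => a i + b i) = C.altSum M a + C.altSum M b := by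
  simp only [altSum, iterate_D_add, mul_add, Finset.sum_add_distrib]

lemma altSum_sub (M : ℕ) (a b : ℕ → R) :
    C.altSum M (fun i => a i - b i) = C.altSum M a - C.altSum M b := by
  simp only [altSum, iterate_D_sub, mul_sub, Finset.sum_sub_distrib]

lemma altSum_smul (M : ℕ) (r : ℝ) (a : ℕ → R) :
    C.altSum M (fun i => r • a i) = r • C.altSum M a := by
  simp only [altSum, iterate_D_smul, mul_smul_comm, Finset.smul_sum]

lemma altSum_finset_sum {ι : Type*} (M : ℕ) (s : Finset ι) (a : ι → ℕ → R) :
    C.altSum M (fun i => ∑ j ∈ s, a j i) = ∑ j ∈ s, C.altSum M (a j) := by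
  classical
  induction s using Finset.induction_on with
  | empty => simp [altSum]
  | insert j s hj ih =>
    simp only [Finset.sum_insert hj, altSum_add, ih]

/-- This recursion is the integration by parts that produces the momenta. -/
lemma altSum_succ' (M : ℕ) (a : ℕ → R) :
    C.altSum (M + 1) a = a 0 - C.D (C.altSum M fun i => a (i + 1)) := by
  simp only [altSum, Finset.sum_range_succ', map_sum, D_neg_one_pow_mul,
    Function.iterate_succ_apply', pow_succ]
  simp
  ring

lemma altSum_congr {M : ℕ} {a b : ℕ → R} (h : ∀ i < M, a i = b i) :
    C.altSum M a = C.altSum M b :=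
  Finset.sum_congr rfl fun i hi => by rw [h i (Finset.mem_range.1 hi)]

/-- `∑ (-D)^i a_i` is the formal adjoint of `A = ∑ a_i D^i` applied to `1`. The adjoint of `D ∘ A`
is `-A^* D`, which kills `1`. In the finite sum everything telescopes, except for minus the
contribution of `a_M` to the omitted index `M + 1`. -/
lemma altSum_compD (M : ℕ) (a : ℕ → R) :
    C.altSum (M + 1) (C.compD a) = (-1) ^ M * C.D^[M + 1] (a M) := by
  induction M with
  | zero => simp [altSum, compD]
  | succ M ih =>
    rw [altSum, Finset.sum_range_succ, ← altSum, ih, compD, iterate_D_add,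
      ← Function.iterate_succ_apply]
    ring

lemma euler_add (F G : R) : C.euler (F + G) = C.euler F + C.euler G := by
  simp only [euler, map_add, altSum_add]

lemma euler_sub (F G : R) : C.euler (F - G) = C.euler F - C.euler G := by
  simp only [euler, map_sub, altSum_sub]

lemma euler_smul (r : ℝ) (F : R) : C.euler (r • F) = r • C.euler F := by
  simp only [euler, Derivation.map_smul, altSum_smul]

lemma d_D_eq_compD (F : R) {i : ℕ} (hi : i ≤ N) :
    C.d i (C.D F) = C.compD (fun i => C.d i F) i := by
  cases i with
  | zero => exact C.d_zero_D F
  | succ i => exact C.d_succ_D i (by omega) F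

/-- Independence of the top coordinate `y_N` removes the boundary term of `altSum_compD`. -/
lemma euler_D {F : R} (h : C.d N F = 0) : C.euler (C.D F) = 0 := by
  rw [euler, C.altSum_congr (b := C.compD fun i => C.d i F)
    fun i hi => C.d_D_eq_compD F (by omega), altSum_compD, h, iterate_D_zero, mul_zero]

/-! #### Order -/

/-- `F` does not depend on `y_i` for `k < i ≤ N`. -/
def OrderLE (k : ℕ) (F : R) : Prop := ∀ i, k < i → i ≤ N → C.d i F = 0

variable {C}

lemma OrderLE.mono {k l : ℕ} {F : R} (h : C.OrderLE k F) (hkl : k ≤ l) : C.OrderLE l F :=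
  fun i hi => h i (by omega)

lemma OrderLE.D {k : ℕ} {F : R} (h : C.OrderLE k F) : C.OrderLE (k + 1) (C.D F) := by
  intro i hi hiN
  obtain ⟨i, rfl⟩ : ∃ j, i = j + 1 := ⟨i - 1, by omega⟩
  rw [C.d_succ_D i (by omega), h (i + 1) (by omega) hiN, h i (by omega) (by omega)]
  simp

lemma OrderLE.iterate_D {k : ℕ} {F : R} (h : C.OrderLE k F) (i : ℕ) :
    C.OrderLE (k + i) (C.D^[i] F) := by
  induction i with
  | zero => exact h
  | succ i ih => rw [Function.iterate_succ_apply']; exact ih.D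

lemma OrderLE.d {k : ℕ} {F : R} (h : C.OrderLE k F) (j : ℕ) : C.OrderLE k (C.d j F) := by
  intro i hi hiN
  rw [C.d_comm, h i hi hiN, map_zero]

lemma OrderLE.sub {k : ℕ} {F G : R} (hF : C.OrderLE k F) (hG : C.OrderLE k G) :
    C.OrderLE k (F - G) := fun i hi hN => by rw [map_sub, hF i hi hN, hG i hi hN, sub_zero]

lemma OrderLE.smul {k : ℕ} {F : R} (r : ℝ) (hF : C.OrderLE k F) :
    C.OrderLE k (r • F) := fun i hi hN => by rw [Derivation.map_smul, hF i hi hN, smul_zero]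

lemma OrderLE.mul {k : ℕ} {F G : R} (hF : C.OrderLE k F) (hG : C.OrderLE k G) :
    C.OrderLE k (F * G) := fun i hi hN => by simp [Derivation.leibniz, hF i hi hN, hG i hi hN]

lemma OrderLE.altSum {k M : ℕ} {a : ℕ → R} (h : ∀ i < M, C.OrderLE (k - i) (a i))
    (hk : M ≤ k + 1) : C.OrderLE k (C.altSum M a) := by
  intro j hj hN
  rw [JetCalc.altSum, map_sum]
  refine Finset.sum_eq_zero fun l hl => ?_
  have hl := Finset.mem_range.1 hl
  rw [d_neg_one_pow_mul, (h l hl).iterate_D l j (by omega) hN, mul_zero]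

/-- `∂_{k+i} D^i F = ∂_k F` for `F` of order at most `k`. -/
lemma OrderLE.d_top_iterate_D {k : ℕ} {F : R} (h : C.OrderLE k F) (i : ℕ) (hi : k + i ≤ N) :
    C.d (k + i) (C.D^[i] F) = C.d k F := by
  induction i with
  | zero => rfl
  | succ i ih =>
    rw [Function.iterate_succ_apply', ← add_assoc, C.d_succ_D _ (by omega),
      h.iterate_D i _ (by omega) (by omega), ih (by omega)]
    simp

/-- `∂_{k+i-1} D^i F = i D ∂_k F + ∂_{k-1} F` for `F` of order at most `k`. -/
lemma OrderLE.d_subtop_iterate_D {k : ℕ} {F : R} (h : C.OrderLE (k + 1) F) (i : ℕ)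
    (hi : k + i ≤ N) :
    C.d (k + i) (C.D^[i] F) = (i : R) * C.D (C.d (k + 1) F) + C.d k F := by
  induction i with
  | zero => simp
  | succ i ih =>
    have := h.d_top_iterate_D i (by omega)
    rw [show k + 1 + i = k + i + 1 by ring] at this
    rw [Function.iterate_succ_apply', ← add_assoc, C.d_succ_D _ (by omega), this, ih (by omega)]
    push_cast
    ring

lemma OrderLE.euler_eq {n : ℕ} {F : R} (h : C.OrderLE n F) (hn : n ≤ N) :
    C.euler F = C.altSum (n + 1) fun i => C.d i F := by
  rw [euler, JetCalc.altSum, JetCalc.altSum]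
  symm
  refine Finset.sum_subset (fun i hi => ?_) fun i hi hi' => ?_
  · simp at hi ⊢; omega
  · simp at hi hi'
    rw [h i (by omega) (by omega), iterate_D_zero, mul_zero]

lemma OrderLE.euler {n : ℕ} {F : R} (h : C.OrderLE n F) (hn : n ≤ N) :
    C.OrderLE (2 * n) (C.euler F) := by
  rw [h.euler_eq hn]
  exact OrderLE.altSum (fun i hi => (h.d i).mono (by omega)) (by omega)

lemma OrderLE.d_top_euler {n : ℕ} {F : R} (h : C.OrderLE n F) (hn : 2 * n ≤ N) :
    C.d (2 * n) (C.euler F) = (-1) ^ n * C.d n (C.d n F) := by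
  rw [h.euler_eq (by omega), JetCalc.altSum, Finset.sum_range_succ, map_add, map_sum,
    Finset.sum_eq_zero, zero_add, d_neg_one_pow_mul, two_mul,
    (h.d n).d_top_iterate_D n (by omega)]
  intro i hi
  have hi := Finset.mem_range.1 hi
  rw [d_neg_one_pow_mul, (h.d i).iterate_D i _ (by omega) hn, mul_zero]

/-- Only the summands `i = n` and `i = n + 1` depend on `y_{2n+1}`. Both contribute `∂_n ∂_{n+1} F`,
with opposite signs; what survives is the commutator term of `D^{n+1}`. -/
lemma OrderLE.d_subtop_euler {n : ℕ} {F : R} (h : C.OrderLE (n + 1) F) (hn : 2 * n + 2 ≤ N) :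
    C.d (2 * n + 1) (C.euler F) =
      (-1) ^ (n + 1) * ((n + 1 : ℕ) : R) * C.D (C.d (n + 1) (C.d (n + 1) F)) := by
  rw [h.euler_eq (by omega), JetCalc.altSum, Finset.sum_range_succ, Finset.sum_range_succ,
    map_add, map_add, map_sum, Finset.sum_eq_zero, zero_add, d_neg_one_pow_mul,
    d_neg_one_pow_mul]
  · have h1 := (h.d n).d_top_iterate_D n (by omega)
    have h2 := (h.d (n + 1)).d_subtop_iterate_D (k := n) (n + 1) (by omega)
    rw [show n + 1 + n = 2 * n + 1 by ring] at h1
    rw [show n + (n + 1) = 2 * n + 1 by ring] at h2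
    rw [h1, h2, C.d_comm n (n + 1), pow_succ]
    ring
  · intro i hi
    have hi := Finset.mem_range.1 hi
    rw [d_neg_one_pow_mul, (h.d i).iterate_D i _ (by omega) (by omega), mul_zero]

/-- A function all of whose total derivative vanishes does not depend on the jet variables. -/
lemma OrderLE.d_eq_zero_of_D_eq_zero {k : ℕ} {F : R} (h : C.OrderLE k F) (hk : k < N)
    (hD : C.D F = 0) : ∀ i ≤ N, C.d i F = 0 := by
  suffices H : ∀ m i, i + m = k + 1 → C.d i F = 0 by
    intro i hi
    rcases lt_or_ge k i with hki | hki
    · exact h i hki hi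
    · exact H (k + 1 - i) i (by omega)
  intro m
  induction m with
  | zero => intro i hi; exact h i (by omega) (by omega)
  | succ m ih =>
    intro i hi
    -- Since `∂_i F = ∂_{i+1} D F - D ∂_{i+1} F`, vanishing descends from `i + 1` to `i`.
    have := C.d_succ_D i (by omega) F
    rw [hD, ih (i + 1) (by omega)] at this
    simpa using this.symm

/-- The multiplier between two variational Euler–Lagrange expressions of order `2n ≥ 4` is a
constant of the motion off shell: its total derivative vanishes. -/
lemma D_multiplier_eq_zero {n : ℕ} (hn : 2 ≤ n) (hN : 2 * n ≤ N) {F G l u : R}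
    (hF : C.OrderLE n F) (hG : C.OrderLE n G) (hl : C.OrderLE n l)
    (hu : u * C.d n (C.d n F) = 1) (hlead : C.d n (C.d n G) = l * C.d n (C.d n F))
    (h : C.euler G = l * C.euler F) : C.D l = 0 := by
  obtain ⟨n, rfl⟩ : ∃ m, n = m + 1 := ⟨n - 1, by omega⟩
  have h1 := hF.d_subtop_euler (by omega)
  have h2 := hG.d_subtop_euler (by omega)
  -- After the shift of `n`, `l` has order `n + 1`, which is less than `2 * n + 1`. This is where `2
  -- ≤ n` is needed.
  rw [h, Derivation.leibniz, hl _ (by omega) (by omega), h1, hlead, Derivation.leibniz] at h2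
  simp only [smul_eq_mul, mul_zero, add_zero] at h2
  have h3 : (-1) ^ (n + 1) * ((n + 1 : ℕ) : R) * (C.d (n + 1) (C.d (n + 1) F) * C.D l) = 0 := by
    linear_combination -h2
  have hc : ((-1) ^ (n + 1) * ((n + 1 : ℕ) : R)) =
      algebraMap ℝ R ((-1) ^ (n + 1) * ((n + 1 : ℕ) : ℝ)) := by simp
  have hne : ((-1) ^ (n + 1) * ((n + 1 : ℕ) : ℝ)) ≠ 0 :=
    mul_ne_zero (pow_ne_zero _ (by norm_num)) (by positivity)
  rw [hc, ← Algebra.smul_def, smul_eq_zero_iff_right hne] at h3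
  linear_combination u * h3 - C.D l * hu

/-! #### Null Lagrangians -/

variable (C)

/-- The momenta `p_i = ∑_l (-D)^l ∂_{i+1+l} F`. -/
def momentum (F : R) (i : ℕ) : R := C.altSum (N - i) fun l => C.d (i + 1 + l) F

/-- With `momentum_zero`, this is integration by parts: the vertical differential of `F` is `D (∑
p_i dy_i) + E(F) dy_0`. -/
lemma momentum_succ (F : R) {i : ℕ} (hi : i < N) :
    C.d (i + 1) F = C.D (C.momentum F (i + 1)) + C.momentum F i := by
  rw [momentum, momentum, show N - i = N - (i + 1) + 1 by omega, altSum_succ']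
  simp only [show ∀ l, i + 1 + 1 + l = i + 1 + (l + 1) by intro l; ring]
  simp

lemma momentum_zero (F : R) : C.d 0 F = C.D (C.momentum F 0) + C.euler F := by
  rw [euler, altSum_succ', momentum]
  simp [add_comm 1]

variable {C}

lemma OrderLE.momentum_eq_zero {n : ℕ} {F : R} (h : C.OrderLE n F) {i : ℕ} (hi : n ≤ i) :
    C.momentum F i = 0 := by
  rw [JetCalc.momentum, JetCalc.altSum]
  refine Finset.sum_eq_zero fun l hl => ?_
  have := Finset.mem_range.1 hl
  rw [h _ (by omega) (by omega), iterate_D_zero, mul_zero]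

lemma OrderLE.momentum {n : ℕ} {F : R} (h : C.OrderLE n F) (i : ℕ) :
    C.OrderLE (2 * n - 1) (C.momentum F i) := by
  intro j hj hN
  rw [JetCalc.momentum, JetCalc.altSum, map_sum]
  refine Finset.sum_eq_zero fun l hl => ?_
  have := Finset.mem_range.1 hl
  rw [d_neg_one_pow_mul]
  rcases lt_or_ge n (i + 1 + l) with h' | h'
  · rw [h _ h' (by omega), iterate_D_zero, map_zero, mul_zero]
  · rw [(h.d _).iterate_D l _ (by omega) hN, mul_zero]

/-- Put `c(i,j) = ∂_i p_j - ∂_j p_i`. Commuting `∂_{i+1}` and `∂_{j+1}` on `F` gives `D c(i+1,j+1) +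
c(i,j+1) + c(i+1,j) = 0`. So `c(i,j+1)` vanishes by induction upwards in `j` and downwards in `i`.
The start is `i = N`, where `p_N = 0` and no momentum depends on `y_N`; for `j = 0` the hypothesis
`E(F) = 0` replaces the missing relation. -/
lemma OrderLE.d_momentum_comm {n : ℕ} {F : R} (h : C.OrderLE n F) (hn : 1 ≤ n) (hN : 2 * n ≤ N)
    (hE : C.euler F = 0) {i j : ℕ} (hi : i ≤ N) (hj : j ≤ N) :
    C.d i (C.momentum F j) = C.d j (C.momentum F i) := by
  set p := C.momentum F with hp
  have hpS : ∀ i < N, C.d (i + 1) F = C.D (p (i + 1)) + p i := fun i hi => C.momentum_succ F hi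
  have hp0 : C.d 0 F = C.D (p 0) := by rw [C.momentum_zero, hE, add_zero]
  suffices H : ∀ j ≤ N, ∀ m i, i + m = N → C.d i (p j) = C.d j (p i) from
    H j hj (N - i) i (by omega)
  intro j
  induction j with
  | zero =>
    intro _ m
    induction m with
    | zero =>
      intro i hi
      obtain rfl : i = N := by omega
      rw [hp, h.momentum_eq_zero (i := i) (by omega), h.momentum 0 i (by omega) le_rfl, map_zero]
    | succ m ih =>
      intro i hi
      have h1 := C.d_comm (i + 1) 0 F
      rw [hp0, hpS i (by omega), map_add, C.d_zero_D, C.d_succ_D i (by omega),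
        ih (i + 1) (by omega)] at h1
      simpa using h1
  | succ j ihj =>
    intro hj m
    induction m with
    | zero =>
      intro i hi
      obtain rfl : i = N := by omega
      rw [hp, h.momentum_eq_zero (i := i) (by omega), h.momentum _ i (by omega) le_rfl, map_zero]
    | succ m ih =>
      intro i hi
      have h1 := C.d_comm (i + 1) (j + 1) F
      rw [hpS j (by omega), hpS i (by omega), map_add, map_add, C.d_succ_D j (by omega),
        C.d_succ_D i (by omega), ih (i + 1) (by omega),
        ihj (by omega) m (i + 1) (by omega)] at h1
      linear_combination h1

/-! #### Transformation of the Euler–Lagrange operator -/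

variable (C)

/-- The functions `Y_j` given by `Y_{j+1} = w D Y_j`. -/
def prolongSeq (w Y₀ : R) (j : ℕ) : R := (fun a => w * C.D a)^[j] Y₀

lemma prolongSeq_succ (w Y₀ : R) (j : ℕ) :
    C.prolongSeq w Y₀ (j + 1) = w * C.D (C.prolongSeq w Y₀ j) :=
  Function.iterate_succ_apply' _ _ _

/-- The coefficients `Z_{j,i} = ∂_i Y_j - Y_{j+1} ∂_i X`. -/
def vertCoeff (w X Y₀ : R) (j i : ℕ) : R :=
  C.d i (C.prolongSeq w Y₀ j) - C.prolongSeq w Y₀ (j + 1) * C.d i X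

variable {C} {w X Y₀ c : R}

/-- The operators `Z_j = ∑ Z_{j,i} D^i` satisfy `Z_{j+1} = w D ∘ Z_j`. This follows from the
commutation relations and `δ w = -w² δ(D X)`. If `Z_0` is multiplication by `c`, as it is for
contact transformations, then `Z_j = (w D)^j ∘ c`. -/
lemma vertCoeff_succ (hw : w * C.D X = 1) (j : ℕ) {i : ℕ} (hi : i ≤ N) :
    C.vertCoeff w X Y₀ (j + 1) i = w * C.compD (C.vertCoeff w X Y₀ j) i := by
  have hdw : ∀ δ : Derivation ℝ R R, δ w = - w * w * δ (C.D X) := by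
    intro δ
    have := congrArg δ hw
    rw [Derivation.leibniz, Derivation.map_one_eq_zero] at this
    simp only [smul_eq_mul] at this
    linear_combination w * this - δ w * hw
  have key : C.compD (C.vertCoeff w X Y₀ j) i = C.d i (C.D (C.prolongSeq w Y₀ j))
      - C.prolongSeq w Y₀ (j + 1) * C.d i (C.D X) -
        C.D (C.prolongSeq w Y₀ (j + 1)) * C.d i X := by
    cases i with
    | zero =>
      simp only [compD, vertCoeff, map_sub, Derivation.leibniz, smul_eq_mul, C.d_zero_D]
      ring
    | succ i =>
      simp only [compD, vertCoeff, map_sub, Derivation.leibniz, smul_eq_mul,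
        C.d_succ_D i (show i < N by omega)]
      ring
  rw [key, vertCoeff, C.prolongSeq_succ w Y₀ (j + 1), C.prolongSeq_succ w Y₀ j,
    Derivation.leibniz, hdw]
  simp only [smul_eq_mul]
  ring

lemma vertCoeff_eq_zero (hw : w * C.D X = 1)
    (h0 : ∀ i ≤ N, C.vertCoeff w X Y₀ 0 i = if i = 0 then c else 0) {j i : ℕ} (hji : j < i)
    (hi : i ≤ N) : C.vertCoeff w X Y₀ j i = 0 := by
  induction j generalizing i with
  | zero => rw [h0 i hi, if_neg (by omega)]
  | succ j ih =>
    obtain ⟨i, rfl⟩ : ∃ k, i = k + 1 := ⟨i - 1, by omega⟩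
    rw [vertCoeff_succ hw j hi, compD, ih (by omega) hi, ih (by omega) (by omega)]
    simp

lemma vertCoeff_self (hw : w * C.D X = 1)
    (h0 : ∀ i ≤ N, C.vertCoeff w X Y₀ 0 i = if i = 0 then c else 0) {j : ℕ} (hj : j ≤ N) :
    C.vertCoeff w X Y₀ j j = c * w ^ j := by
  induction j with
  | zero => simp [h0 0 hj]
  | succ j ih =>
    rw [vertCoeff_succ hw j hj, compD, vertCoeff_eq_zero hw h0 (by omega) hj, ih (by omega),
      map_zero]
    ring

/-- The left side is the formal adjoint of `(w D)^j ∘ c` applied to `D X * a`. As `w * D X = 1`, one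
has `-D (w * D X * a) = -D X * (w * D a)`, so each factor `w D` passes to `a` at the cost of a sign.
-/
lemma altSum_vertCoeff (hw : w * C.D X = 1)
    (h0 : ∀ i ≤ N, C.vertCoeff w X Y₀ 0 i = if i = 0 then c else 0) {j : ℕ} (hj : j ≤ N) (a : R) :
    C.altSum (N + 1) (fun i => C.D X * a * C.vertCoeff w X Y₀ j i) =
      (-1) ^ j * (C.D X * c * (fun b => w * C.D b)^[j] a) := by
  induction j generalizing a with
  | zero =>
    rw [altSum, Finset.sum_eq_single 0]
    · simp [h0 0 hj]; ring
    · intro i hi hi0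
      have := Finset.mem_range.1 hi
      rw [h0 i (by omega), if_neg hi0, mul_zero, iterate_D_zero, mul_zero]
    · simp
  | succ j ih =>
    have key : C.altSum (N + 1) (fun i => C.D X * a * C.vertCoeff w X Y₀ (j + 1) i) =
        C.altSum (N + 1) (fun i => C.compD (fun i => a * C.vertCoeff w X Y₀ j i) i
          - C.D X * (w * C.D a) * C.vertCoeff w X Y₀ j i) := by
      refine C.altSum_congr fun i hi => ?_
      rw [vertCoeff_succ hw j (by omega)]
      cases i with
      | zero =>
        simp only [compD, Derivation.leibniz, smul_eq_mul]
        linear_combination (a * C.D (C.vertCoeff w X Y₀ j 0)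
          + C.D a * C.vertCoeff w X Y₀ j 0) * hw
      | succ i =>
        simp only [compD, Derivation.leibniz, smul_eq_mul]
        linear_combination (a * C.D (C.vertCoeff w X Y₀ j (i + 1)) + a * C.vertCoeff w X Y₀ j i
          + C.D a * C.vertCoeff w X Y₀ j (i + 1)) * hw
    rw [key, altSum_sub, altSum_compD, vertCoeff_eq_zero hw h0 (by omega) le_rfl, mul_zero,
      iterate_D_zero, ih (by omega), Function.iterate_succ_apply, pow_succ]
    ring

/-- The transformation law of the Euler–Lagrange operator. -/
theorem euler_mul_D (hw : w * C.D X = 1)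
    (h0 : ∀ i ≤ N, C.vertCoeff w X Y₀ 0 i = if i = 0 then c else 0) (hX : C.d N X = 0)
    {F : R} {f : ℕ → R} (hF : ∀ i ≤ N, C.d i F =
      ∑ j ∈ Finset.range (N + 1), f j * C.vertCoeff w X Y₀ j i + C.d i X * (w * C.D F)) :
    C.euler (F * C.D X) =
      C.D X * c * ∑ j ∈ Finset.range (N + 1), (-1) ^ j * (fun b => w * C.D b)^[j] (f j) := by
  -- The variation of `F * D X` splits into a vertical part and the variation `D ∘ (F ∂_i X)` along
  -- the `X`-direction; the latter is a total derivative and contributes nothing.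
  have key : C.euler (F * C.D X) = C.altSum (N + 1) (fun i =>
      ∑ j ∈ Finset.range (N + 1), C.D X * f j * C.vertCoeff w X Y₀ j i
        + C.compD (fun i => F * C.d i X) i) := by
    refine C.altSum_congr fun i hi => ?_
    rw [Derivation.leibniz, hF i (by omega), C.d_D_eq_compD X (by omega)]
    have : ∑ j ∈ Finset.range (N + 1), C.D X * f j * C.vertCoeff w X Y₀ j i =
        C.D X * ∑ j ∈ Finset.range (N + 1), f j * C.vertCoeff w X Y₀ j i := by
      rw [Finset.mul_sum]; exact Finset.sum_congr rfl fun j _ => by ring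
    rw [this]
    cases i with
    | zero =>
      simp only [compD, Derivation.leibniz, smul_eq_mul]
      linear_combination (C.d 0 X * C.D F) * hw
    | succ i =>
      simp only [compD, Derivation.leibniz, smul_eq_mul]
      linear_combination (C.d (i + 1) X * C.D F) * hw
  rw [key, altSum_add, altSum_compD, hX, mul_zero, iterate_D_zero, mul_zero, add_zero,
    altSum_finset_sum, Finset.mul_sum]
  refine Finset.sum_congr rfl fun j hj => ?_
  rw [altSum_vertCoeff hw h0 (by have := Finset.mem_range.1 hj; omega)]
  ring

end JetCalc

/-! ### Rings of smooth functions on open sets -/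

section SmoothRing

variable {E : Type*} [NormedAddCommGroup E] [NormedSpace ℝ E]

/-- The algebra of smooth functions on an open subset of a normed space. -/
def smoothRing (U : Opens E) : Subalgebra ℝ (U → ℝ) where
  carrier := {F | ∃ G : E → ℝ, ContDiffOn ℝ ∞ G U ∧ ∀ p : U, F p = G p}
  mul_mem' := by
    rintro F F' ⟨G, hG, h⟩ ⟨G', hG', h'⟩
    exact ⟨fun p => G p * G' p, hG.mul hG', fun p => by simp [h, h']⟩
  add_mem' := by
    rintro F F' ⟨G, hG, h⟩ ⟨G', hG', h'⟩
    exact ⟨fun p => G p + G' p, hG.add hG', fun p => by simp [h, h']⟩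
  algebraMap_mem' := fun r => ⟨fun _ => r, contDiffOn_const, fun p => rfl⟩

variable {U : Opens E}

namespace smoothRing

instance : CoeFun (smoothRing U) fun _ => U → ℝ := ⟨fun F => F.1⟩

/-- The restriction to `U` of a function which is smooth on `U`. -/
def mk (G : E → ℝ) (hG : ContDiffOn ℝ ∞ G U) : smoothRing U := ⟨fun p => G p, G, hG, fun _ => rfl⟩

@[simp] lemma mk_apply (G : E → ℝ) (hG : ContDiffOn ℝ ∞ G U) (p : U) : mk G hG p = G p := rfl

@[ext] lemma ext {F G : smoothRing U} (h : ∀ p : U, F p = G p) : F = G :=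
  Subtype.ext (funext h)

@[simp] lemma add_apply (F G : smoothRing U) (p : U) : (F + G) p = F p + G p := rfl
@[simp] lemma sub_apply (F G : smoothRing U) (p : U) : (F - G) p = F p - G p := rfl
@[simp] lemma mul_apply (F G : smoothRing U) (p : U) : (F * G) p = F p * G p := rfl
@[simp] lemma smul_apply (r : ℝ) (F : smoothRing U) (p : U) : (r • F) p = r * F p := rfl
@[simp] lemma zero_apply (p : U) : (0 : smoothRing U) p = 0 := rfl
@[simp] lemma one_apply (p : U) : (1 : smoothRing U) p = 1 := rfl
@[simp] lemma pow_apply (F : smoothRing U) (n : ℕ) (p : U) : (F ^ n) p = F p ^ n := rfl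

lemma sum_apply {ι : Type*} (s : Finset ι) (F : ι → smoothRing U) (p : U) :
    (∑ i ∈ s, F i) p = ∑ i ∈ s, F i p := by
  classical
  induction s using Finset.induction_on with
  | empty => simp
  | insert a s ha ih => simp [Finset.sum_insert ha, ih]

lemma exists_mk (F : smoothRing U) : ∃ G hG, F = mk (U := U) G hG := by
  obtain ⟨G, hG, h⟩ := F.2
  exact ⟨G, hG, ext h⟩

/-- A function on the whole space which represents `F` on `U`. -/
def toFun (F : smoothRing U) : E → ℝ := (exists_mk F).choose

lemma contDiffOn_toFun (F : smoothRing U) : ContDiffOn ℝ ∞ (toFun F) U :=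
  (exists_mk F).choose_spec.choose

lemma toFun_apply (F : smoothRing U) (p : U) : (toFun F) p = F p := by
  conv_rhs => rw [(exists_mk F).choose_spec.choose_spec]
  rfl

lemma toFun_of_mem (F : smoothRing U) {p : E} (hp : p ∈ U) : (toFun F) p = F ⟨p, hp⟩ :=
  (toFun_apply F) ⟨p, hp⟩

lemma contDiffOn_fderiv {G : E → ℝ} (hG : ContDiffOn ℝ ∞ G U) :
    ContDiffOn ℝ ∞ (fderiv ℝ G) U :=
  ((contDiffOn_infty_iff_fderiv_of_isOpen U.isOpen).1 hG).2

lemma differentiableAt {G : E → ℝ} (hG : ContDiffOn ℝ ∞ G U) (p : U) :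
    DifferentiableAt ℝ G p :=
  (hG.contDiffAt (U.isOpen.mem_nhds p.2)).differentiableAt (by simp)

lemma contDiffOn_fderiv_apply {G : E → ℝ} (hG : ContDiffOn ℝ ∞ G U) {v : E → E}
    (hv : ContDiff ℝ ∞ v) : ContDiffOn ℝ ∞ (fun p => fderiv ℝ G p (v p)) U :=
  (contDiffOn_fderiv hG).clm_apply hv.contDiffOn

lemma fderiv_congr {G G' : E → ℝ} (h : ∀ p : U, G p = G' p) (p : U) :
    fderiv ℝ G p = fderiv ℝ G' p :=
  Filter.EventuallyEq.fderiv_eq <| by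
    filter_upwards [U.isOpen.mem_nhds p.2] with q hq using h ⟨q, hq⟩

/-- The derivation of the algebra of smooth functions given by a smooth vector field. -/
def fieldDeriv (v : E → E) (hv : ContDiff ℝ ∞ v) : Derivation ℝ (smoothRing U) (smoothRing U) :=
  Derivation.mk'
    { toFun := fun F => mk (fun p => fderiv ℝ (toFun F) p (v p))
        (contDiffOn_fderiv_apply (contDiffOn_toFun F) hv)
      map_add' := fun F G => by
        ext p
        have := fderiv_congr (U := U) (G := (toFun (F + G))) (G' := (toFun F) + (toFun G))
          (fun p => by simp [toFun_apply]) p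
        simp only [mk_apply, add_apply, this]
        rw [fderiv_add (differentiableAt (contDiffOn_toFun F) p)
          (differentiableAt (contDiffOn_toFun G) p)]
        rfl
      map_smul' := fun r F => by
        ext p
        have := fderiv_congr (U := U) (G := (toFun (r • F))) (G' := r • (toFun F))
          (fun p => by simp [toFun_apply]) p
        simp only [mk_apply, smul_apply, this, RingHom.id_apply]
        rw [fderiv_const_smul (differentiableAt (contDiffOn_toFun F) p)]
        rfl }
    fun F G => by
      ext p
      have := fderiv_congr (U := U) (G := (toFun (F * G))) (G' := (toFun F) * (toFun G))
        (fun p => by simp [toFun_apply]) p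
      simp only [LinearMap.coe_mk, AddHom.coe_mk, mk_apply, this, smul_eq_mul, add_apply, mul_apply]
      rw [fderiv_mul (differentiableAt (contDiffOn_toFun F) p)
        (differentiableAt (contDiffOn_toFun G) p)]
      simp [toFun_apply]

lemma fieldDeriv_apply {v : E → E} (hv : ContDiff ℝ ∞ v) (F : smoothRing U) {G : E → ℝ}
    (h : ∀ p : U, F p = G p) (p : U) : fieldDeriv v hv F p = fderiv ℝ G p (v p) := by
  change fderiv ℝ (toFun F) p (v p) = _
  rw [fderiv_congr (U := U) (fun p => ((toFun_apply F) p).trans (h p)) p]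

/-- The bracket of the constant field `e` with `v` is the derivative of `v` in direction `e`; the
second derivatives of `F` cancel by symmetry. A constant `A` suffices because the truncated total
derivative field is affine. -/
lemma fieldDeriv_const_comm {v : E → E} (hv : ContDiff ℝ ∞ v) {A : E →L[ℝ] E}
    (hA : ∀ p, HasFDerivAt v A p) (e : E) (F : smoothRing U) :
    fieldDeriv (fun _ => e) contDiff_const (fieldDeriv v hv F) =
      fieldDeriv v hv (fieldDeriv (fun _ => e) contDiff_const F) +
        fieldDeriv (fun _ => A e) contDiff_const F := by
  obtain ⟨G, hG, rfl⟩ := (exists_mk F)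
  ext p
  have hG2 : HasFDerivAt (fderiv ℝ G) (fderiv ℝ (fderiv ℝ G) p) p :=
    (((contDiffOn_fderiv hG).contDiffAt (U.isOpen.mem_nhds p.2)).differentiableAt
      (by simp)).hasFDerivAt
  rw [add_apply, fieldDeriv_apply _ _ (G := fun p => fderiv ℝ G p (v p))
      (fun q => fieldDeriv_apply hv _ (fun _ => rfl) q) p,
    fieldDeriv_apply _ _ (G := fun p => fderiv ℝ G p e)
      (fun q => fieldDeriv_apply contDiff_const _ (fun _ => rfl) q) p,
    fieldDeriv_apply _ _ (fun _ => rfl) p,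
    (hG2.clm_apply (hA p)).fderiv, (hG2.clm_apply (hasFDerivAt_const e _)).fderiv]
  have hsymm : IsSymmSndFDerivAt ℝ G p :=
    (hG.contDiffAt (U.isOpen.mem_nhds p.2)).isSymmSndFDerivAt 
      (by simpa using WithTop.coe_le_coe.2 (le_top (a := (2 : ℕ∞))))
  simp [hsymm.eq e (v p)]
  ring

lemma fieldDeriv_const_const_comm (e e' : E) (F : smoothRing U) :
    fieldDeriv (fun _ => e) contDiff_const (fieldDeriv (fun _ => e') contDiff_const F) =
      fieldDeriv (fun _ => e') contDiff_const (fieldDeriv (fun _ => e) contDiff_const F) := by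
  rw [fieldDeriv_const_comm contDiff_const (A := 0) (fun p => hasFDerivAt_const _ _)]
  conv_rhs => rw [← add_zero (fieldDeriv _ _ (fieldDeriv _ _ F))]
  congr 1
  ext p
  rw [fieldDeriv_apply _ _ (fun p => ((toFun_apply F) p).symm)]
  simp

end smoothRing

end SmoothRing

/-! ### The total and partial derivatives on `J^N` -/

/-- The coordinate vector field `∂_{y_i}` on `J^N`, which is zero for `i > N`. -/
def basisY (N i : ℕ) : Jet N := (0, fun j => if (j : ℕ) = i then 1 else 0)

lemma basisY_eq_single {N : ℕ} (i : Fin (N + 1)) : basisY N i = (0, Pi.single i 1) := by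
  simp only [basisY, Prod.mk.injEq, true_and]
  ext j
  simp [Pi.single_apply, Fin.ext_iff]

lemma basisY_of_lt {N i : ℕ} (h : N < i) : basisY N i = 0 := by
  ext j
  · rfl
  · simp only [basisY]
    rw [if_neg (by omega)]
    rfl

/-- The linear part of the truncated total derivative field. -/
def shift (N : ℕ) : Jet N →L[ℝ] Jet N :=
  LinearMap.toContinuousLinearMap (E := Jet N)
    { toFun := fun v =>
        -- The value `0` in the last coordinate is the truncation `y_{N+1} = 0`.
        (0, fun j : Fin (N + 1) => if h : (j : ℕ) + 1 < N + 1 then v.2 ⟨j + 1, h⟩ else 0)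
      map_add' := fun v w => by
        ext j
        · simp
        · by_cases h : (j : ℕ) < N <;> simp [h]
      map_smul' := fun r v => by
        ext j
        · simp
        · by_cases h : (j : ℕ) < N <;> simp [h] }

lemma shift_apply {N : ℕ} (v : Jet N) :
    shift N v = (0, fun j : Fin (N + 1) => if h : (j : ℕ) + 1 < N + 1 then v.2 ⟨j + 1, h⟩ else 0) := rfl

/-- The truncated total derivative as a vector field on `J^N`. -/
def totalField (N : ℕ) (p : Jet N) : Jet N := (1, 0) + shift N p

lemma contDiff_totalField (N : ℕ) : ContDiff ℝ ∞ (totalField N) :=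
  contDiff_const.add (shift N).contDiff

lemma hasFDerivAt_totalField (N : ℕ) (p : Jet N) : HasFDerivAt (totalField N) (shift N) p :=
  (shift N).hasFDerivAt.const_add _

lemma shift_basisY_zero (N : ℕ) : shift N (basisY N 0) = 0 := by
  rw [shift_apply]
  ext j
  · rfl
  · simp [basisY]

lemma shift_basisY_succ {N i : ℕ} (hi : i < N) : shift N (basisY N (i + 1)) = basisY N i := by
  rw [shift_apply]
  ext j
  · rfl
  · by_cases h : (j : ℕ) < N
    · simp [basisY, h]
    · simp [basisY, h]
      omega

/-- The total and partial derivatives as derivations of the smooth functions on `U ⊆ J^N`. -/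
def jetCalc {N : ℕ} (U : Opens (Jet N)) : JetCalc (smoothRing U) N where
  D := smoothRing.fieldDeriv (totalField N) (contDiff_totalField N)
  d i := smoothRing.fieldDeriv (fun _ => basisY N i) contDiff_const
  d_zero_D a := by
    rw [smoothRing.fieldDeriv_const_comm _ (hasFDerivAt_totalField N)]
    simp only [shift_basisY_zero, add_eq_left]
    ext p
    rw [smoothRing.fieldDeriv_apply _ _ (fun p => ((smoothRing.toFun_apply a) p).symm)]
    simp
  d_succ_D i hi a := by
    rw [smoothRing.fieldDeriv_const_comm _ (hasFDerivAt_totalField N)]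
    simp only [shift_basisY_succ hi]
  d_comm i j a := smoothRing.fieldDeriv_const_const_comm _ _ _

section Coordinates

variable {N : ℕ} {U : Opens (Jet N)}

/-- The derivation `∂_x` of the smooth functions on `U ⊆ J^N`. -/
def partialX (U : Opens (Jet N)) : Derivation ℝ (smoothRing U) (smoothRing U) :=
  smoothRing.fieldDeriv (fun _ => (1, 0)) contDiff_const

lemma D_apply (F : smoothRing U) {G : Jet N → ℝ} (h : ∀ p : U, F p = G p) (p : U) :
    (jetCalc U).D F p = fderiv ℝ G p (totalField N p) :=
  smoothRing.fieldDeriv_apply (contDiff_totalField N) F h p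

lemma d_apply (F : smoothRing U) {G : Jet N → ℝ} (h : ∀ p : U, F p = G p) (i : ℕ) (p : U) :
    (jetCalc U).d i F p = fderiv ℝ G p (basisY N i) :=
  smoothRing.fieldDeriv_apply (v := fun _ => basisY N i) contDiff_const F h p

lemma partialX_apply (F : smoothRing U) {G : Jet N → ℝ} (h : ∀ p : U, F p = G p) (p : U) :
    partialX U F p = fderiv ℝ G p (1, 0) := smoothRing.fieldDeriv_apply _ F h p

lemma jet_eq_sum (v : Jet N) : v = v.1 • ((1, 0) : Jet N) + ∑ i, v.2 i • basisY N i := by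
  ext j
  · simp [basisY, Prod.fst_sum]
  · simp [basisY_eq_single, Prod.snd_sum, Pi.single_apply]

lemma fderiv_apply_eq_sum (F : smoothRing U) {G : Jet N → ℝ} (h : ∀ p : U, F p = G p) (p : U)
    (v : Jet N) : fderiv ℝ G p v = v.1 * partialX U F p +
      ∑ i : Fin (N + 1), v.2 i * (jetCalc U).d i F p := by
  conv_lhs => rw [jet_eq_sum v]
  rw [map_add, map_smul, map_sum, partialX_apply F h]
  simp only [map_smul, smul_eq_mul, d_apply F h]

end Coordinates

/-! ### Projections, extensions and functions pulled back from lower jet spaces -/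

section Projection

variable {k m N : ℕ}

/-- The projection `J^N → J^k` as a linear map. -/
def projL (h : k ≤ N) : Jet N →L[ℝ] Jet k :=
  LinearMap.toContinuousLinearMap (E := Jet N)
    { toFun := proj h
      map_add' := fun _ _ => rfl
      map_smul' := fun _ _ => rfl }

@[simp] lemma projL_apply (h : k ≤ N) (p : Jet N) : projL h p = proj h p := rfl

lemma contDiff_proj (h : k ≤ N) : ContDiff ℝ ∞ (proj h) := (projL h).contDiff

lemma continuous_proj (h : k ≤ N) : Continuous (proj h) := (projL h).continuous

lemma hasFDerivAt_proj (h : k ≤ N) (p : Jet N) : HasFDerivAt (proj h) (projL h) p :=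
  (projL h).hasFDerivAt

lemma proj_proj (h : k ≤ m) (h' : m ≤ N) (p : Jet N) :
    proj h (proj h' p) = proj (h.trans h') p := rfl

lemma proj_self (p : Jet k) : proj le_rfl p = p := rfl

/-- The extension of a `k`-jet to an `N`-jet by the higher coordinates of `p`. -/
def extendBy (p : Jet N) (q : Jet k) : Jet N :=
  (q.1, fun i => if h : (i : ℕ) < k + 1 then q.2 ⟨i, h⟩ else p.2 i)

/-- The extension of jets by zero. -/
def extendL (k N : ℕ) : Jet k →L[ℝ] Jet N :=
  LinearMap.toContinuousLinearMap (E := Jet k)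
    { toFun := extendBy 0
      map_add' := fun v w => by
        ext j
        · rfl
        · by_cases h : (j : ℕ) ≤ k <;> simp [extendBy, h]
      map_smul' := fun r v => by
        ext j
        · rfl
        · by_cases h : (j : ℕ) ≤ k <;> simp [extendBy, h] }

lemma extendL_apply (q : Jet k) : extendL k N q = extendBy 0 q := rfl

lemma extendBy_eq (p : Jet N) (q : Jet k) : extendBy p q = extendL k N q + extendBy p (0 : Jet k) := by
  rw [extendL_apply]
  ext j
  · simp [extendBy]
  · by_cases h : (j : ℕ) ≤ k <;> simp [extendBy, h]

lemma hasFDerivAt_extendBy (p : Jet N) (q : Jet k) :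
    HasFDerivAt (extendBy p) (extendL k N) q := by
  rw [show (extendBy p : Jet k → Jet N) = fun q => extendL k N q + extendBy p (0 : Jet k) from
    funext (extendBy_eq p)]
  exact (extendL k N).hasFDerivAt.add_const _

lemma contDiff_extendBy (p : Jet N) : ContDiff ℝ ∞ (extendBy p : Jet k → Jet N) := by
  rw [show (extendBy p : Jet k → Jet N) = fun q => extendL k N q + extendBy p (0 : Jet k) from
    funext (extendBy_eq p)]
  exact (extendL k N).contDiff.add contDiff_const

lemma proj_extendBy (h : k ≤ N) (p : Jet N) (q : Jet k) : proj h (extendBy p q) = q := by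
  ext j
  · rfl
  · have := Nat.le_of_lt_succ j.2
    simp [proj, extendBy, this]

lemma extendBy_proj (h : k ≤ N) (p : Jet N) : extendBy p (proj h p) = p := by
  ext j
  · rfl
  · simp [proj, extendBy]

lemma proj_totalField (h : k + 1 ≤ N) (p : Jet N) :
    proj (k.le_succ.trans h) (totalField N p) = (1, fun i => (proj h p).2 i.succ) := by
  ext j
  · simp [proj, totalField, shift_apply]
  · simp only [proj, totalField, shift_apply, Prod.snd_add, Pi.add_apply, Fin.val_castLE]
    rw [dif_pos (by omega)]
    simp [Fin.castLE]

lemma proj_basisY (h : k ≤ N) (i : ℕ) : proj h (basisY N i) = basisY k i := rfl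

end Projection

section Represents

variable {k m N : ℕ} {U : Opens (Jet N)}

/-- The smooth function `F` on `U ⊆ J^N` is the pull-back of the function `G` on `J^k`. -/
def Represents (F : smoothRing U) (h : k ≤ N) (G : Jet k → ℝ) : Prop :=
  ∀ p : U, F p = G (proj h p)

namespace Represents

variable {F : smoothRing U} {h : k ≤ N} {G : Jet k → ℝ}

/-- No regularity of `G` is assumed: near `proj h p` it is `F` composed with the affine section
`extendBy p`, hence differentiable there. -/
lemma fderiv_apply (hF : Represents F h G) (p : U) (v : Jet N) :
    fderiv ℝ (smoothRing.toFun F) p v = fderiv ℝ G (proj h p) (proj h v) := by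
  have hFd := (smoothRing.differentiableAt (smoothRing.contDiffOn_toFun F) p).hasFDerivAt
  have hcont : ContinuousAt (extendBy (p : Jet N) : Jet k → Jet N) (proj h p) :=
    (contDiff_extendBy _).continuous.continuousAt
  have hnhds : ∀ᶠ q in 𝓝 (proj h (p : Jet N)), extendBy (p : Jet N) q ∈ U := by
    refine hcont.eventually_mem ?_
    rw [extendBy_proj]
    exact U.isOpen.mem_nhds p.2
  have hG : DifferentiableAt ℝ G (proj h p) := by
    have h1 : HasFDerivAt (fun q => smoothRing.toFun F (extendBy (p : Jet N) q))
        ((fderiv ℝ (smoothRing.toFun F) p).comp (extendL k N)) (proj h p) := by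
      refine HasFDerivAt.comp _ ?_ (hasFDerivAt_extendBy _ _)
      rw [extendBy_proj]
      exact hFd
    refine (h1.congr_of_eventuallyEq ?_).differentiableAt
    filter_upwards [hnhds] with q hq
    rw [smoothRing.toFun_of_mem F hq, hF ⟨_, hq⟩, proj_extendBy]
  rw [smoothRing.fderiv_congr (U := U) (G' := fun q => G (proj h q))
    (fun q => (smoothRing.toFun_apply F q).trans (hF q)) p,
    show fderiv ℝ (fun q => G (proj h q)) p = _ from
      (hG.hasFDerivAt.comp (p : Jet N) (hasFDerivAt_proj h p)).fderiv]
  rfl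

/-- The bound on `k` keeps the truncated `D` equal to the true total derivative. -/
lemma D (hF : Represents F h G) (hk : k + 1 ≤ N) :
    Represents ((jetCalc U).D F) hk (totalDeriv G) := by
  intro p
  rw [D_apply F (fun p => (smoothRing.toFun_apply F p).symm), hF.fderiv_apply,
    proj_totalField hk]
  rfl

lemma iterate_D (hF : Represents F h G) (i : ℕ) (hi : k + i ≤ N) :
    Represents ((jetCalc U).D^[i] F) hi (iterTotalDeriv G i) := by
  induction i with
  | zero => exact hF
  | succ i ih =>
    rw [Function.iterate_succ_apply']
    exact (ih (by omega)).D hi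

lemma d (hF : Represents F h G) (i : Fin (k + 1)) :
    Represents ((jetCalc U).d i F) h (partialY G i) := by
  intro p
  rw [d_apply F (fun p => (smoothRing.toFun_apply F p).symm), hF.fderiv_apply, proj_basisY,
    basisY_eq_single]
  rfl

lemma orderLE (hF : Represents F h G) : (jetCalc U).OrderLE k F := by
  intro i hi _
  ext p
  rw [d_apply F (fun p => (smoothRing.toFun_apply F p).symm), hF.fderiv_apply, proj_basisY,
    basisY_of_lt hi, map_zero]
  rfl

end Represents

lemma smoothRing.exists_inv {E : Type*} [NormedAddCommGroup E] [NormedSpace ℝ E] {U : Opens E}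
    (F : smoothRing U) (hF : ∀ p : U, F p ≠ 0) : ∃ w : smoothRing U, w * F = 1 := by
  refine ⟨smoothRing.mk (fun p => (smoothRing.toFun F p)⁻¹)
    ((smoothRing.contDiffOn_toFun F).inv fun p hp => ?_), ?_⟩
  · rw [smoothRing.toFun_of_mem F hp]
    exact hF _
  · ext p
    simp [smoothRing.toFun_apply, hF p]

namespace Lagrangian

variable {n : ℕ} (L : Lagrangian n)

/-- The Lagrange function as a smooth function on `U ⊆ J^N`. -/
def elem (h : n ≤ N) (hU : ∀ p ∈ U, proj h p ∈ L.dom) : smoothRing U :=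
  smoothRing.mk (fun p => L.f (proj h p)) (L.smooth.comp (contDiff_proj h).contDiffOn hU)

lemma represents_elem (h : n ≤ N) (hU : ∀ p ∈ U, proj h p ∈ L.dom) :
    Represents (L.elem h hU) h L.f := fun _ => rfl

lemma represents_euler (h : n ≤ N) (hN : 2 * n ≤ N) (hU : ∀ p ∈ U, proj h p ∈ L.dom) :
    Represents ((jetCalc U).euler (L.elem h hU)) hN L.eulerLagrange := by
  intro p
  have hL := L.represents_elem h hU
  rw [hL.orderLE.euler_eq h, JetCalc.altSum, smoothRing.sum_apply, Finset.sum_range,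
    eulerLagrange]
  refine Finset.sum_congr rfl fun i _ => ?_
  rw [smoothRing.mul_apply, (hL.d i).iterate_D i (by omega) p]
  rfl

lemma d_d_elem_ne_zero (h : n ≤ N) (hU : ∀ p ∈ U, proj h p ∈ L.dom) (p : U) :
    (jetCalc U).d n ((jetCalc U).d n (L.elem h hU)) p ≠ 0 := by
  have := ((L.represents_elem h hU).d (Fin.last n)).d (Fin.last n) p
  rw [Fin.val_last] at this
  rw [this]
  exact L.nondegenerate _ (hU p p.2)

end Lagrangian

end Represents

/-! ### Prolongations of contact transformations -/

namespace ContactTransformation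

variable (φ : ContactTransformation)

lemma differentiableAt {q : Jet 1} (hq : q ∈ φ.toMap.source) :
    DifferentiableAt ℝ φ.toMap q :=
  (φ.smooth.contDiffAt (φ.toMap.open_source.mem_nhds hq)).differentiableAt (by simp)

lemma contDiffOn_X : ContDiffOn ℝ ∞ φ.X φ.toMap.source := contDiff_fst.comp_contDiffOn φ.smooth

lemma contDiffOn_Y (i : Fin 2) : ContDiffOn ℝ ∞ (fun q => (φ.toMap q).2 i) φ.toMap.source :=
  ((contDiff_apply ℝ ℝ i).comp contDiff_snd).comp_contDiffOn φ.smooth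

/-- The total derivative direction, on which the right side vanishes, gives `D Y_0 = Y_1 D X`; the
directions `∂_{y_0}` and `∂_{y_1}` give `Z_{0,0} = c` and `Z_{0,1} = 0`. -/
lemma exists_contact {q : Jet 1} (hq : q ∈ φ.toMap.source) : ∃ c : ℝ, c ≠ 0 ∧ ∀ v : Jet 1,
    fderiv ℝ (fun q => (φ.toMap q).2 0) q v - (φ.toMap q).2 1 * fderiv ℝ φ.X q v =
      c * (v.2 0 - q.2 1 * v.1) := by
  obtain ⟨c, hc, h⟩ := φ.contact q hq
  refine ⟨c, hc, fun v => ?_⟩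
  have hd := (φ.differentiableAt hq).hasFDerivAt
  have hX : HasFDerivAt φ.X _ q := hd.fst
  have hY : HasFDerivAt (fun q => (φ.toMap q).2 0) _ q := (hasFDerivAt_pi'.1 hd.snd) 0
  rw [hX.fderiv, hY.fderiv]
  have := DFunLike.congr_fun h v
  simpa [pullback, contactForm, dy, dx] using this

variable {φ} {N : ℕ} {U : Opens (Jet N)}

/-- The function `X` on `U ⊆ J^N`. -/
def elemX (hN : 1 ≤ N) (hU : ∀ p ∈ U, proj hN p ∈ φ.toMap.source) : smoothRing U :=
  smoothRing.mk (fun p => φ.X (proj hN p))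
    (φ.contDiffOn_X.comp (contDiff_proj hN).contDiffOn hU)

/-- The functions `Y_0` and `Y_1` on `U ⊆ J^N`. -/
def elemY (hN : 1 ≤ N) (hU : ∀ p ∈ U, proj hN p ∈ φ.toMap.source) (i : Fin 2) : smoothRing U :=
  smoothRing.mk (fun p => (φ.toMap (proj hN p)).2 i)
    ((φ.contDiffOn_Y i).comp (contDiff_proj hN).contDiffOn hU)

variable (hN : 1 ≤ N) (hU : ∀ p ∈ U, proj hN p ∈ φ.toMap.source)

lemma represents_X : Represents (elemX hN hU) hN φ.X := fun _ => rfl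

lemma represents_Y (i : Fin 2) :
    Represents (elemY hN hU i) hN fun q => (φ.toMap q).2 i := fun _ => rfl

lemma D_elemY_zero (hN' : 2 ≤ N) :
    (jetCalc U).D (elemY hN hU 0) = elemY hN hU 1 * (jetCalc U).D (elemX hN hU) := by
  ext p
  obtain ⟨c, -, hc⟩ := φ.exists_contact (hU p p.2)
  rw [smoothRing.mul_apply, (represents_Y hN hU 0).D hN' p, (represents_X hN hU).D hN' p,
    represents_Y hN hU 1 p]
  have := hc (1, fun i => (proj hN' (p : Jet N)).2 i.succ)
  rw [mul_one, show (proj hN' (p : Jet N)).2 (Fin.succ 0) = (proj hN (p : Jet N)).2 1 from rfl,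
    sub_self, mul_zero] at this
  exact sub_eq_zero.1 this

variable {w : smoothRing U} (hw : w * (jetCalc U).D (elemX hN hU) = 1)

include hw in
lemma prolongSeq_one (hN' : 2 ≤ N) :
    (jetCalc U).prolongSeq w (elemY hN hU 0) 1 = elemY hN hU 1 := by
  change w * (jetCalc U).D (elemY hN hU 0) = _
  rw [D_elemY_zero hN hU hN']
  linear_combination (elemY hN hU 1) * hw

end ContactTransformation

namespace ContactTransformation

variable {φ : ContactTransformation} {N : ℕ} {U : Opens (Jet N)}
  (hN : 1 ≤ N) (hU : ∀ p ∈ U, proj hN p ∈ φ.toMap.source)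
  {w : smoothRing U} (hw : w * (jetCalc U).D (elemX hN hU) = 1)

include hw in
lemma represents_prolongSeq (i : ℕ) (hi : i + 1 ≤ N) (hN' : 2 ≤ N) :
    Represents ((jetCalc U).prolongSeq w (elemY hN hU 0) (i + 1)) hi (φ.prolongY i) := by
  induction i with
  | zero =>
    rw [prolongSeq_one hN hU hw hN']
    exact represents_Y hN hU 1
  | succ i ih =>
    intro p
    have hwp : w p * totalDeriv φ.X (proj hN' p) = 1 := by
      rw [← (represents_X hN hU).D hN' p, ← smoothRing.mul_apply, hw]
      rfl
    rw [JetCalc.prolongSeq_succ, smoothRing.mul_apply, (ih (by omega)).D hi p]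
    change _ = totalDeriv (φ.prolongY i) (proj hi p) / totalDeriv φ.X (proj hN' p)
    rw [eq_div_iff (right_ne_zero_of_mul_eq_one hwp), mul_right_comm, hwp, one_mul]

include hw in
lemma prolong_snd_apply (hN' : 2 ≤ N) (p : U) (i : Fin (N + 1)) :
    (φ.prolong hN p).2 i = (jetCalc U).prolongSeq w (elemY hN hU 0) i p := by
  obtain ⟨i, hi⟩ := i
  cases i with
  | zero => rfl
  | succ i => exact (represents_prolongSeq hN hU hw i (by omega) hN' p).symm

include hU hw in
lemma contDiffOn_prolong (hN' : 2 ≤ N) : ContDiffOn ℝ ∞ (φ.prolong hN) U := by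
  refine ContDiffOn.prodMk (smoothRing.contDiffOn_toFun (elemX hN hU) |>.congr fun p hp => ?_)
    (contDiffOn_pi.2 fun i => smoothRing.contDiffOn_toFun
      ((jetCalc U).prolongSeq w (elemY hN hU 0) i) |>.congr fun p hp => ?_)
  · rw [smoothRing.toFun_of_mem _ hp]
    rfl
  · rw [smoothRing.toFun_of_mem _ hp, ← prolong_snd_apply hN hU hw hN']
    rfl

lemma vertCoeff_zero_eq (hN' : 2 ≤ N) (hw : w * (jetCalc U).D (elemX hN hU) = 1) (i : ℕ) :
    (jetCalc U).vertCoeff w (elemX hN hU) (elemY hN hU 0) 0 i =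
      (jetCalc U).d i (elemY hN hU 0) - elemY hN hU 1 * (jetCalc U).d i (elemX hN hU) := by
  rw [JetCalc.vertCoeff, zero_add, prolongSeq_one hN hU hw hN']
  rfl

include hw in
lemma vertCoeff_zero (hN' : 2 ≤ N) (i : ℕ) (hi : i ≤ N) :
    (jetCalc U).vertCoeff w (elemX hN hU) (elemY hN hU 0) 0 i = if i = 0 then
      (jetCalc U).vertCoeff w (elemX hN hU) (elemY hN hU 0) 0 0 else 0 := by
  rcases i with _ | _ | i
  · rfl
  · rw [if_neg (by omega), vertCoeff_zero_eq hN hU hN' hw]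
    ext p
    obtain ⟨c, -, hc⟩ := φ.exists_contact (hU p p.2)
    have := hc (0, Pi.single 1 1)
    simp only [ne_eq, zero_ne_one, not_false_eq_true, Pi.single_eq_of_ne, mul_zero, sub_self] at this
    rw [smoothRing.sub_apply, smoothRing.mul_apply, represents_Y hN hU 1 p]
    exact (congrArg₂ _ ((represents_Y hN hU 0).d 1 p)
      (congrArg _ ((represents_X hN hU).d 1 p))).trans this
  · rw [if_neg (by omega), vertCoeff_zero_eq hN hU hN' hw,
      (represents_Y hN hU 0).orderLE _ (by omega) hi,
      (represents_X hN hU).orderLE _ (by omega) hi, mul_zero, sub_zero]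

include hw in
lemma vertCoeff_zero_zero_ne_zero (hN' : 2 ≤ N) (p : U) :
    (jetCalc U).vertCoeff w (elemX hN hU) (elemY hN hU 0) 0 0 p ≠ 0 := by
  rw [vertCoeff_zero_eq hN hU hN' hw]
  obtain ⟨c, hc0, hc⟩ := φ.exists_contact (hU p p.2)
  have := hc (0, Pi.single 0 1)
  simp only [Pi.single_eq_same, mul_zero, sub_zero, mul_one] at this
  rw [smoothRing.sub_apply, smoothRing.mul_apply, represents_Y hN hU 1 p]
  rw [← this] at hc0
  intro h
  exact hc0 <| (congrArg₂ _ ((represents_Y hN hU 0).d 0 p)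
      (congrArg _ ((represents_X hN hU).d 0 p))).symm.trans h

/-- The pull-back of smooth functions along the prolongation. -/
def pull {U' : Opens (Jet N)} (hN' : 2 ≤ N) (hU' : ∀ p ∈ U, φ.prolong hN p ∈ U')
    (G : smoothRing U') : smoothRing U :=
  smoothRing.mk (fun p => smoothRing.toFun G (φ.prolong hN p))
    ((smoothRing.contDiffOn_toFun G).comp (contDiffOn_prolong hN hU hw hN') hU')

/-! ### Chain rule and Euler–Lagrange operator under prolongation -/

section Pull

variable {U' : Opens (Jet N)} (hN' : 2 ≤ N) (hU' : ∀ p ∈ U, φ.prolong hN p ∈ U')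

lemma pull_apply (G : smoothRing U') (p : U) :
    pull hN hU hw hN' hU' G p = G ⟨φ.prolong hN p, hU' p p.2⟩ :=
  smoothRing.toFun_of_mem G (hU' p p.2)

lemma pull_zero : pull hN hU hw hN' hU' 0 = 0 := by
  ext p
  rw [pull_apply]
  rfl

/-- The chain rule for the prolongation. -/
lemma fieldDeriv_pull {v : Jet N → Jet N} (hv : ContDiff ℝ ∞ v) (G : smoothRing U') :
    smoothRing.fieldDeriv v hv (pull hN hU hw hN' hU' G) =
      pull hN hU hw hN' hU' (partialX U' G) * smoothRing.fieldDeriv v hv (elemX hN hU) +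
      ∑ j ∈ Finset.range (N + 1), pull hN hU hw hN' hU' ((jetCalc U').d j G) *
        smoothRing.fieldDeriv v hv ((jetCalc U).prolongSeq w (elemY hN hU 0) j) := by
  ext p
  have hΦ : HasFDerivAt (φ.prolong hN) (fderiv ℝ (φ.prolong hN) p) p :=
    (((contDiffOn_prolong hN hU hw hN').contDiffAt (U.isOpen.mem_nhds p.2)).differentiableAt
      (by simp)).hasFDerivAt
  have hG := (smoothRing.differentiableAt (smoothRing.contDiffOn_toFun G)
    ⟨φ.prolong hN p, hU' p p.2⟩).hasFDerivAt
  rw [smoothRing.fieldDeriv_apply _ _ (G := smoothRing.toFun G ∘ φ.prolong hN) (fun _ => rfl), (hG.comp (p : Jet N) hΦ).fderiv,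
    ContinuousLinearMap.comp_apply,
    fderiv_apply_eq_sum G (fun q => (smoothRing.toFun_apply G q).symm), smoothRing.add_apply,
    smoothRing.mul_apply, smoothRing.sum_apply, Finset.sum_range, pull_apply,
    smoothRing.fieldDeriv_apply hv (elemX hN hU) (G := fun p => (φ.prolong hN p).1)
      (fun _ => rfl), hΦ.fst.fderiv]
  refine congrArg₂ _ (mul_comm _ _) (Finset.sum_congr rfl fun i _ => ?_)
  rw [smoothRing.mul_apply, pull_apply, smoothRing.fieldDeriv_apply hv _
    (G := fun p => (φ.prolong hN p).2 i) (fun q => (prolong_snd_apply hN hU hw hN' q i).symm),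
    ((hasFDerivAt_pi'.1 hΦ.snd) i).fderiv]
  exact mul_comm _ _

lemma mul_D_pull_eq_sum (G : smoothRing U') :
    w * (jetCalc U).D (pull hN hU hw hN' hU' G) = pull hN hU hw hN' hU' (partialX U' G) +
      ∑ j ∈ Finset.range (N + 1), pull hN hU hw hN' hU' ((jetCalc U').d j G) *
        (jetCalc U).prolongSeq w (elemY hN hU 0) (j + 1) := by
  have := fieldDeriv_pull hN hU hw hN' hU' (contDiff_totalField N) G
  change (jetCalc U).D _ = _ * (jetCalc U).D _ + ∑ j ∈ _, _ * (jetCalc U).D _ at this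
  rw [this, mul_add, Finset.mul_sum]
  refine congrArg₂ _ (by linear_combination (pull hN hU hw hN' hU' (partialX U' G)) * hw)
    (Finset.sum_congr rfl fun j _ => ?_)
  rw [JetCalc.prolongSeq_succ]
  ring

/-- Eliminating `∂_x G` between the chain rules for `∂_i` and for `D` gives the shape that
`euler_mul_D` requires. -/
lemma d_pull (G : smoothRing U') (i : ℕ) :
    (jetCalc U).d i (pull hN hU hw hN' hU' G) =
      ∑ j ∈ Finset.range (N + 1), pull hN hU hw hN' hU' ((jetCalc U').d j G) *
        (jetCalc U).vertCoeff w (elemX hN hU) (elemY hN hU 0) j i +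
      (jetCalc U).d i (elemX hN hU) * (w * (jetCalc U).D (pull hN hU hw hN' hU' G)) := by
  rw [mul_D_pull_eq_sum]
  have := fieldDeriv_pull hN hU hw hN' hU' (v := fun _ => basisY N i) contDiff_const G
  change (jetCalc U).d i _ = _ * (jetCalc U).d i _ + ∑ j ∈ _, _ * (jetCalc U).d i _ at this
  have aux : ∀ (s : Finset ℕ) (A Y Z : ℕ → smoothRing U) (x : smoothRing U),
      ∑ j ∈ s, A j * (Y j - Z j * x) = ∑ j ∈ s, A j * Y j - (∑ j ∈ s, A j * Z j) * x := by
    intro s A Y Z x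
    rw [Finset.sum_mul, ← Finset.sum_sub_distrib]
    exact Finset.sum_congr rfl fun j _ => by ring
  simp only [JetCalc.vertCoeff]
  rw [this, aux]
  ring

/-- The truncations on the two sides disagree at the top: the source supplies the coefficient
`Y_{N+1}`, the target supplies `0`. Independence of `y_N` makes this harmless. -/
lemma mul_D_pull (G : smoothRing U') (hG : (jetCalc U').d N G = 0) :
    w * (jetCalc U).D (pull hN hU hw hN' hU' G) =
      pull hN hU hw hN' hU' ((jetCalc U').D G) := by
  rw [mul_D_pull_eq_sum]
  ext p
  rw [smoothRing.add_apply, smoothRing.sum_apply, Finset.sum_range, pull_apply, pull_apply,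
    D_apply G (fun q => (smoothRing.toFun_apply G q).symm),
    fderiv_apply_eq_sum G (fun q => (smoothRing.toFun_apply G q).symm)]
  refine congrArg₂ _ (by simp [totalField, shift_apply]) (Finset.sum_congr rfl fun i _ => ?_)
  rw [smoothRing.mul_apply, pull_apply, mul_comm]
  by_cases hi : (i : ℕ) = N
  · rw [hi, hG]
    simp
  · have hi' : (i : ℕ) + 1 < N + 1 := by omega
    rw [← prolong_snd_apply hN hU hw hN' p ⟨i + 1, hi'⟩]
    congr 1
    have hi'' : (i : ℕ) < N := by omega
    simp [totalField, shift_apply, hi'']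

lemma iterate_mul_D_pull (j : ℕ) {k : ℕ} {G : smoothRing U'} (hG : (jetCalc U').OrderLE k G)
    (hk : k + j ≤ N) :
    (fun b => w * (jetCalc U).D b)^[j] (pull hN hU hw hN' hU' G) =
      pull hN hU hw hN' hU' ((jetCalc U').D^[j] G) := by
  induction j with
  | zero => rfl
  | succ j ih =>
    rw [Function.iterate_succ_apply', Function.iterate_succ_apply', ih (by omega),
      mul_D_pull _ _ _ _ _ _ ((hG.iterate_D j) N (by omega) le_rfl)]

lemma pull_finset_sum (s : Finset ℕ) (G : ℕ → smoothRing U') :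
    pull hN hU hw hN' hU' (∑ j ∈ s, G j) = ∑ j ∈ s, pull hN hU hw hN' hU' (G j) := by
  ext p
  simp only [pull_apply, smoothRing.sum_apply]

lemma pull_neg_one_pow_mul (j : ℕ) (G : smoothRing U') :
    pull hN hU hw hN' hU' ((-1) ^ j * G) = (-1) ^ j * pull hN hU hw hN' hU' G := by
  ext p
  simp only [pull_apply, smoothRing.mul_apply]
  rfl

/-- The Euler–Lagrange expression of the pull-back of a Lagrangian along a contact
transformation. -/
theorem euler_pull {n : ℕ} {G : smoothRing U'} (hG : (jetCalc U').OrderLE n G)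
    (hn : 2 * n ≤ N) :
    (jetCalc U).euler (pull hN hU hw hN' hU' G * (jetCalc U).D (elemX hN hU)) =
      (jetCalc U).D (elemX hN hU) *
        (jetCalc U).vertCoeff w (elemX hN hU) (elemY hN hU 0) 0 0 *
        pull hN hU hw hN' hU' ((jetCalc U').euler G) := by
  rw [JetCalc.euler_mul_D hw (vertCoeff_zero hN hU hw hN')
    ((represents_X hN hU).orderLE N (by omega) le_rfl)
    (fun i _ => d_pull hN hU hw hN' hU' G i), JetCalc.euler, JetCalc.altSum, pull_finset_sum]
  refine congrArg _ (Finset.sum_congr rfl fun j hj => ?_)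
  rw [pull_neg_one_pow_mul]
  congr 1
  rcases le_or_gt j n with h | h
  · exact iterate_mul_D_pull hN hU hw hN' hU' j (hG.d j) (by omega)
  · have hj := Finset.mem_range.1 hj
    have hw0 : ∀ j : ℕ, (fun b => w * (jetCalc U).D b)^[j] 0 = 0 := by
      intro j
      induction j with
      | zero => rfl
      | succ j ih => simp only [Function.iterate_succ_apply, map_zero, mul_zero, ih]
    rw [hG j h (by omega), JetCalc.iterate_D_zero, pull_zero, hw0]

/-- The derivative of a pull-back by the highest coordinate. -/
lemma d_top_pull {k : ℕ} {G : smoothRing U'} (hG : (jetCalc U').OrderLE k G) (hk : 2 ≤ k)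
    (hkN : k ≤ N) : (jetCalc U).d k (pull hN hU hw hN' hU' G) =
      pull hN hU hw hN' hU' ((jetCalc U').d k G) *
        ((jetCalc U).vertCoeff w (elemX hN hU) (elemY hN hU 0) 0 0 * w ^ k) := by
  rw [d_pull, (represents_X hN hU).orderLE k (by omega) hkN, zero_mul, add_zero,
    Finset.sum_eq_single k, JetCalc.vertCoeff_self hw (vertCoeff_zero hN hU hw hN') hkN]
  · intro j hj hjk
    have hj := Finset.mem_range.1 hj
    rcases lt_or_gt_of_ne hjk with h | h
    · rw [JetCalc.vertCoeff_eq_zero hw (vertCoeff_zero hN hU hw hN') h hkN, mul_zero]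
    · rw [hG j h (by omega), pull_zero, zero_mul]
  · intro h
    exact absurd (Finset.mem_range.2 (by omega)) h

/-- The pull-back of a function of order `n` has order `n`. -/
lemma orderLE_pull {k : ℕ} {G : smoothRing U'} (hG : (jetCalc U').OrderLE k G) (hk : 1 ≤ k) :
    (jetCalc U).OrderLE k (pull hN hU hw hN' hU' G) := by
  intro i hi hiN
  rw [d_pull, (represents_X hN hU).orderLE i (by omega) hiN, zero_mul, add_zero]
  refine Finset.sum_eq_zero fun j hj => ?_
  have hj := Finset.mem_range.1 hj
  rcases lt_or_ge j i with h | h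
  · rw [JetCalc.vertCoeff_eq_zero hw (vertCoeff_zero hN hU hw hN') h hiN, mul_zero]
  · rw [hG j (by omega) (by omega), pull_zero, zero_mul]

end Pull

end ContactTransformation

/-! ### Primitives and null Lagrangians -/

section Primitive

variable {N : ℕ} {U : Opens (Jet N)}

/-- The coordinate function `y_j` on `U ⊆ J^N`. -/
def coordY (U : Opens (Jet N)) (j : ℕ) : smoothRing U :=
  if h : j < N + 1 then smoothRing.mk (fun p => p.2 ⟨j, h⟩)
    ((contDiff_apply ℝ ℝ (⟨j, h⟩ : Fin (N + 1))).comp contDiff_snd).contDiffOn else 0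

lemma coordY_apply {j : ℕ} (h : j < N + 1) (p : U) : coordY U j p = (p : Jet N).2 ⟨j, h⟩ := by
  rw [coordY, dif_pos h]
  rfl

lemma d_coordY {j : ℕ} (h : j < N + 1) (i : ℕ) :
    (jetCalc U).d i (coordY U j) = if i = j then 1 else 0 := by
  ext p
  have h1 : HasFDerivAt (fun p : Jet N => p.2 ⟨j, h⟩) (dy N ⟨j, h⟩) p := (dy N ⟨j, h⟩).hasFDerivAt
  rw [d_apply (coordY U j) (G := fun p => p.2 ⟨j, h⟩) (coordY_apply h), h1.fderiv]
  by_cases hij : i = j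
  · simp [dy, basisY, hij]
  · simp [dy, basisY, hij, Ne.symm hij]

lemma D_eq_sum (F : smoothRing U) : (jetCalc U).D F =
    partialX U F + ∑ i ∈ Finset.range N, coordY U (i + 1) * (jetCalc U).d i F := by
  ext p
  rw [D_apply F (fun q => (smoothRing.toFun_apply F q).symm),
    fderiv_apply_eq_sum F (fun q => (smoothRing.toFun_apply F q).symm), smoothRing.add_apply,
    smoothRing.sum_apply, Finset.sum_range, Fin.sum_univ_castSucc]
  simp [totalField, shift_apply, coordY_apply]

/-- The Poincaré lemma for one-forms `a dx + ∑ b_i dy_i` on convex open subsets of `J^N`. -/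
lemma exists_primitive (hU : Convex ℝ (U : Set (Jet N))) (a : smoothRing U) (b : ℕ → smoothRing U)
    (hab : ∀ i ≤ N, (jetCalc U).d i a = partialX U (b i))
    (hbb : ∀ i ≤ N, ∀ j ≤ N, (jetCalc U).d i (b j) = (jetCalc U).d j (b i)) :
    ∃ μ : smoothRing U, partialX U μ = a ∧ ∀ i ≤ N, (jetCalc U).d i μ = b i := by
  set η : Jet N → Jet N →L[ℝ] ℝ := fun p =>
    smoothRing.toFun a p • dx N + ∑ i : Fin (N + 1), smoothRing.toFun (b i) p • dy N i with hη
  have hηs : ContDiffOn ℝ ∞ η U :=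
    ((smoothRing.contDiffOn_toFun a).smul contDiffOn_const).add
      (ContDiffOn.sum fun i _ => (smoothRing.contDiffOn_toFun (b i)).smul contDiffOn_const)
  have hηd : ∀ (p : U) (v u : Jet N), fderiv ℝ η p v u =
      fderiv ℝ (smoothRing.toFun a) p v * u.1 +
        ∑ i : Fin (N + 1), fderiv ℝ (smoothRing.toFun (b i)) p v * u.2 i := by
    intro p v u
    have hd : ∀ F : smoothRing U, HasFDerivAt (smoothRing.toFun F)
        (fderiv ℝ (smoothRing.toFun F) p) p := fun F =>
      (smoothRing.differentiableAt (smoothRing.contDiffOn_toFun F) p).hasFDerivAt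
    have h1 : HasFDerivAt η _ (p : Jet N) := ((hd a).smul_const (dx N)).add
      (HasFDerivAt.fun_sum fun i _ => (hd (b i)).smul_const (dy N i))
    rw [h1.fderiv]
    simp [dx, dy]
  obtain ⟨μ, hμ⟩ := hU.exists_forall_hasFDerivAt_of_fderiv_symmetric U.isOpen
    (hηs.differentiableOn (by simp)) (by
      intro p hp v u
      have hF := fun F : smoothRing U =>
        fderiv_apply_eq_sum F (fun q => (smoothRing.toFun_apply F q).symm) ⟨p, hp⟩
      rw [hηd ⟨p, hp⟩, hηd ⟨p, hp⟩]
      simp only [hF, add_mul, Finset.sum_mul, Finset.sum_add_distrib]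
      rw [Finset.sum_comm (f := fun i j : Fin (N + 1) => v.2 j * _ * u.2 i)]
      have e1 : ∀ i : Fin (N + 1), (jetCalc U).d i a = partialX U (b i) := fun i =>
        hab i (by omega)
      have e2 : ∀ i j : Fin (N + 1), (jetCalc U).d i (b j) = (jetCalc U).d j (b i) := fun i j =>
        hbb i (by omega) j (by omega)
      have s1 : ∀ v u : Jet N, ∑ i : Fin (N + 1), v.2 i * (jetCalc U).d i a ⟨p, hp⟩ * u.1 =
          ∑ i : Fin (N + 1), u.1 * partialX U (b i) ⟨p, hp⟩ * v.2 i := by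
        intro v u
        refine Finset.sum_congr rfl fun i _ => ?_
        rw [e1 i]
        ring
      have s2 : ∑ i : Fin (N + 1), ∑ j : Fin (N + 1),
            v.2 i * (jetCalc U).d i (b j) ⟨p, hp⟩ * u.2 j =
          ∑ i : Fin (N + 1), ∑ j : Fin (N + 1),
            u.2 j * (jetCalc U).d j (b i) ⟨p, hp⟩ * v.2 i := by
        refine Finset.sum_congr rfl fun i _ => Finset.sum_congr rfl fun j _ => ?_
        rw [e2 i j]
        ring
      rw [s1 v u, s1 u v, s2]
      ring)
  have hμs : ContDiffOn ℝ ∞ μ U := by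
    rw [contDiffOn_infty_iff_fderiv_of_isOpen U.isOpen]
    exact ⟨fun p hp => (hμ p hp).differentiableAt.differentiableWithinAt,
      hηs.congr fun p hp => (hμ p hp).fderiv⟩
  refine ⟨smoothRing.mk μ hμs, ?_, fun i hi => ?_⟩
  · ext p
    rw [partialX_apply _ (fun _ => rfl), (hμ p p.2).fderiv, ← smoothRing.toFun_apply a p]
    simp [hη, dx, dy]
  · ext p
    obtain ⟨i, rfl⟩ : ∃ j : Fin (N + 1), (j : ℕ) = i := ⟨⟨i, by omega⟩, rfl⟩
    rw [d_apply _ (fun _ => rfl), (hμ p p.2).fderiv, ← smoothRing.toFun_apply (b i) p]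
    simp [hη, dx, dy, basisY_eq_single, Pi.single_apply]

/-- A Lagrangian of order `n` with vanishing Euler–Lagrange expression is a total derivative. -/
theorem exists_D_eq_of_euler_eq_zero (hU : Convex ℝ (U : Set (Jet N))) {n : ℕ} (hn : 1 ≤ n)
    (hN : 2 * n ≤ N) {F : smoothRing U} (hF : (jetCalc U).OrderLE n F)
    (hE : (jetCalc U).euler F = 0) :
    ∃ μ : smoothRing U, (∀ i, n ≤ i → i ≤ N → (jetCalc U).d i μ = 0) ∧ (jetCalc U).D μ = F := by
  have hcomm : ∀ i ≤ N, ∀ j ≤ N, _ := fun i hi j hj => hF.d_momentum_comm hn hN hE hi hj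
  set p := (jetCalc U).momentum F with hp
  -- The coefficient of `dx` is forced by `D μ = F` once `∂_i μ = p_i`. In its closedness,
  -- differentiating `y_j` yields the extra `p_{j-1}` that `momentum_succ` accounts for.
  obtain ⟨μ, hμx, hμ⟩ := exists_primitive hU
    (F - ∑ i ∈ Finset.range N, coordY U (i + 1) * p i) p (by
      intro j hj
      have hD : partialX U (p j) = (jetCalc U).D (p j) -
          ∑ i ∈ Finset.range N, coordY U (i + 1) * (jetCalc U).d i (p j) := by
        rw [D_eq_sum]
        ring
      rw [hD, map_sub, map_sum]
      have hsum : ∑ i ∈ Finset.range N, (jetCalc U).d j (coordY U (i + 1) * p i) =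
          ∑ i ∈ Finset.range N, coordY U (i + 1) * (jetCalc U).d i (p j) +
            ∑ i ∈ Finset.range N, if j = i + 1 then p i else 0 := by
        rw [← Finset.sum_add_distrib]
        refine Finset.sum_congr rfl fun i hi => ?_
        have hi := Finset.mem_range.1 hi
        rw [Derivation.leibniz, d_coordY (by omega), hcomm j hj i (by omega)]
        split_ifs <;> simp
      rw [hsum]
      cases j with
      | zero =>
        rw [JetCalc.momentum_zero, hE, Finset.sum_eq_zero (s := Finset.range N)
          (f := fun i => if 0 = i + 1 then p i else 0) (by simp)]
        ring
      | succ j =>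
        rw [JetCalc.momentum_succ _ _ (by omega), Finset.sum_eq_single (s := Finset.range N)
          (f := fun i => if j + 1 = i + 1 then p i else 0) j (by simp; omega) (by simp; omega)]
        simp only [if_true]
        ring) hcomm
  refine ⟨μ, fun i hi hiN => ?_, ?_⟩
  · rw [hμ i hiN, hp, hF.momentum_eq_zero hi]
  · have hsum : ∑ i ∈ Finset.range N, coordY U (i + 1) * (jetCalc U).d i μ =
        ∑ i ∈ Finset.range N, coordY U (i + 1) * p i :=
      Finset.sum_congr rfl fun i hi => by rw [hμ i (Finset.mem_range.1 hi).le]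
    rw [D_eq_sum, hμx, hsum]
    ring

/-- A smooth function on a convex open set all of whose derivatives vanish is constant. -/
lemma eq_of_D_eq_zero (hU : Convex ℝ (U : Set (Jet N))) {F : smoothRing U}
    (hD : (jetCalc U).D F = 0) (hd : ∀ i ≤ N, (jetCalc U).d i F = 0) (p q : U) : F p = F q := by
  have hx : partialX U F = 0 := by
    rw [D_eq_sum, Finset.sum_eq_zero fun i hi => by
      rw [hd i (Finset.mem_range.1 hi).le, mul_zero], add_zero] at hD
    exact hD
  rw [← smoothRing.toFun_apply F p, ← smoothRing.toFun_apply F q]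
  refine U.isOpen.is_const_of_fderiv_eq_zero hU.isPreconnected
    ((smoothRing.contDiffOn_toFun F).differentiableOn (by simp)) (fun r hr => ?_) p.2 q.2
  refine ContinuousLinearMap.ext fun v => ?_
  rw [fderiv_apply_eq_sum F (fun q => (smoothRing.toFun_apply F q).symm) ⟨r, hr⟩, hx,
    Finset.sum_eq_zero fun i _ => by rw [hd i (by omega), smoothRing.zero_apply, mul_zero]]
  simp

end Primitive

/-! ### Functions affine in one coordinate and points of the equation -/

namespace smoothRing

lemma hasDerivAt_line {N : ℕ} {U : Opens (Jet N)} (F : smoothRing U) (p : Jet N) (i : ℕ) (s t : ℝ)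
    (ht : p + (t * s) • basisY N i ∈ U) :
    HasDerivAt (fun t : ℝ => toFun F (p + (t * s) • basisY N i))
      (s * (jetCalc U).d i F ⟨_, ht⟩) t := by
  have h1 : HasDerivAt (fun t : ℝ => p + (t * s) • basisY N i) ((1 * s) • basisY N i) t :=
    (((hasDerivAt_id t).mul_const s).smul_const _).const_add p
  have h2 := (differentiableAt (contDiffOn_toFun F) ⟨_, ht⟩).hasFDerivAt
  have h3 := h2.comp_hasDerivAt t h1
  rw [one_mul, map_smul, smul_eq_mul] at h3
  rw [d_apply F (fun q => (toFun_apply F q).symm)]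
  exact h3

/-- A function whose derivative by `y_i` does not depend on `y_i` is affine in `y_i`. -/
lemma toFun_add_smul_basisY {N : ℕ} {U : Opens (Jet N)} {F : smoothRing U} {i : ℕ}
    (hF : (jetCalc U).d i ((jetCalc U).d i F) = 0) (p : Jet N) (s : ℝ)
    (hseg : ∀ t ∈ Set.Icc (0 : ℝ) 1, p + (t * s) • basisY N i ∈ U) :
    toFun F (p + s • basisY N i) = toFun F p + s * toFun ((jetCalc U).d i F) p := by
  have hc : ∀ t ∈ Set.Icc (0 : ℝ) 1, toFun ((jetCalc U).d i F) (p + (t * s) • basisY N i) =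
      toFun ((jetCalc U).d i F) p := by
    intro t ht
    have := constant_of_has_deriv_right_zero (a := (0 : ℝ)) (b := 1)
      (f := fun t => toFun ((jetCalc U).d i F) (p + (t * s) • basisY N i))
      (fun t ht => (hasDerivAt_line _ p i s t (hseg t ht)).continuousAt.continuousWithinAt)
      (fun t ht => by
        have := hasDerivAt_line ((jetCalc U).d i F) p i s t (hseg t ⟨ht.1, ht.2.le⟩)
        rw [hF, zero_apply, mul_zero] at this
        exact this.hasDerivWithinAt) t ht
    simpa using this
  have hd : ∀ t (ht : t ∈ Set.Icc (0 : ℝ) 1), HasDerivAt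
      (fun t => toFun F (p + (t * s) • basisY N i) - t * (s * toFun ((jetCalc U).d i F) p))
      0 t := by
    intro t ht
    have h1 := (hasDerivAt_line F p i s t (hseg t ht)).sub
      ((hasDerivAt_id t).mul_const (s * toFun ((jetCalc U).d i F) p))
    rw [← toFun_apply, hc t ht, one_mul, sub_self] at h1
    exact h1
  have := constant_of_has_deriv_right_zero (a := (0 : ℝ)) (b := 1)
    (f := fun t => toFun F (p + (t * s) • basisY N i) - t * (s * toFun ((jetCalc U).d i F) p))
    (fun t ht => (hd t ht).continuousAt.continuousWithinAt)
    (fun t ht => (hd t ⟨ht.1, ht.2.le⟩).hasDerivWithinAt) 1 ⟨zero_le_one, le_rfl⟩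
  simp only [one_mul, zero_mul, zero_smul, add_zero, sub_zero] at this
  linarith

end smoothRing

/-- The preimage of an open subset of `J^k` in `J^N`. -/
def cylinder {k N : ℕ} (h : k ≤ N) {V : Set (Jet k)} (hV : IsOpen V) : Opens (Jet N) :=
  ⟨{p | proj h p ∈ V}, hV.preimage (continuous_proj h)⟩

/-- Over each jet of the domain of a Lagrangian there is a point of its Euler–Lagrange equation. -/
lemma Lagrangian.exists_mem_equation {n : ℕ} (hn : 1 ≤ n) (L : Lagrangian n) {a : Jet n}
    (ha : a ∈ L.dom) : ∃ b ∈ L.equation, proj (by omega : n ≤ 2 * n) b = a := by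
  have h : n ≤ 2 * n := by omega
  set U := cylinder h L.isOpen_dom
  have hU : ∀ p ∈ U, proj h p ∈ L.dom := fun p hp => hp
  set F := L.elem h hU
  have hF : (jetCalc U).OrderLE n F := (L.represents_elem h hU).orderLE
  have hd := hF.d_top_euler le_rfl
  have hdd : (jetCalc U).d (2 * n) ((jetCalc U).d (2 * n) ((jetCalc U).euler F)) = 0 := by
    rw [hd, JetCalc.d_neg_one_pow_mul, ((hF.d n).d n) _ (by omega) le_rfl, mul_zero]
  set b₀ : Jet (2 * n) := extendBy 0 a
  have hpb : ∀ s : ℝ, proj h (b₀ + s • basisY (2 * n) (2 * n)) = a := by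
    intro s
    rw [← projL_apply, map_add, map_smul, projL_apply, projL_apply, proj_extendBy, proj_basisY,
      basisY_of_lt (by omega), smul_zero, add_zero]
  have hmem : ∀ s : ℝ, b₀ + s • basisY (2 * n) (2 * n) ∈ U := fun s => by
    change proj h _ ∈ L.dom
    rwa [hpb]
  have hb₀ : b₀ ∈ U := by simpa using hmem 0
  set c := smoothRing.toFun ((jetCalc U).d (2 * n) ((jetCalc U).euler F)) b₀
  have hc : c ≠ 0 := by
    rw [show c = _ from smoothRing.toFun_of_mem _ hb₀, hd]
    refine mul_ne_zero ?_ (L.d_d_elem_ne_zero h hU _)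
    exact pow_ne_zero _ (by simp)
  -- A Newton step in `y_{2n}`: it is exact because the expression is affine, and the whole line
  -- stays over `a`.
  set s : ℝ := -(smoothRing.toFun ((jetCalc U).euler F) b₀) / c
  have key := smoothRing.toFun_add_smul_basisY hdd b₀ s fun t _ => hmem _
  refine ⟨b₀ + s • basisY (2 * n) (2 * n), ⟨hmem s, ?_⟩, hpb s⟩
  rw [smoothRing.toFun_of_mem _ (hmem s), L.represents_euler h le_rfl hU] at key
  rw [proj_self] at key
  rw [key]
  simp only [s]
  field_simp
  ring

namespace ContactTransformation

variable (φ : ContactTransformation)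

lemma isOpen_prolongDomain {k : ℕ} (hk : 2 ≤ k) : IsOpen (φ.prolongDomain hk) := by
  set W : Opens (Jet 2) := cylinder (by omega : 1 ≤ 2) φ.toMap.open_source
  set F := (jetCalc W).D (elemX (by omega : 1 ≤ 2) fun p hp => hp)
  have hF : Represents F le_rfl (totalDeriv φ.X) := (represents_X _ _).D le_rfl
  have h : IsOpen ((W : Set (Jet 2)) ∩ smoothRing.toFun F ⁻¹' {0}ᶜ) :=
    (smoothRing.contDiffOn_toFun F).continuousOn.isOpen_inter_preimage W.isOpen
      isOpen_compl_singleton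
  convert h.preimage (continuous_proj hk) using 1
  ext p
  constructor
  · rintro ⟨h1, h2⟩
    refine ⟨h1, ?_⟩
    rwa [Set.mem_preimage, smoothRing.toFun_of_mem F (p := proj hk p) h1, hF]
  · rintro ⟨h1, h2⟩
    refine ⟨h1, ?_⟩
    rwa [Set.mem_preimage, smoothRing.toFun_of_mem F (p := proj hk p) h1, hF] at h2

variable {φ} {N : ℕ} {U : Opens (Jet N)}

lemma exists_inv_D_elemX (hN : 2 ≤ N) (hU : (U : Set (Jet N)) ⊆ φ.prolongDomain hN) :
    ∃ w : smoothRing U, w * (jetCalc U).D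
      (elemX (by omega : 1 ≤ N) fun _ hp => (hU hp).1) = 1 := by
  refine smoothRing.exists_inv _ fun p => ?_
  rw [(represents_X (by omega : 1 ≤ N) fun _ hp => (hU hp).1).D hN p]
  exact (hU p.2).2

lemma contDiffOn_prolong_of_subset (hN : 2 ≤ N) (hU : (U : Set (Jet N)) ⊆ φ.prolongDomain hN) :
    ContDiffOn ℝ ∞ (φ.prolong (by omega : 1 ≤ N)) U := by
  obtain ⟨w, hw⟩ := exists_inv_D_elemX hN hU
  exact contDiffOn_prolong _ _ hw hN

lemma dx_comp_fderiv_prolong (hN : 2 ≤ N) {q : Jet N} (hq : q ∈ φ.prolongDomain hN) :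
    (dx N).comp (fderiv ℝ (φ.prolong (by omega : 1 ≤ N)) q) =
      (fderiv ℝ φ.X (proj (by omega) q)).comp (projL (by omega : 1 ≤ N)) := by
  have h1 : HasFDerivAt (φ.prolong (by omega : 1 ≤ N)) _ q :=
    (((contDiffOn_prolong_of_subset (U := ⟨_, φ.isOpen_prolongDomain hN⟩) hN subset_rfl).contDiffAt
      ((φ.isOpen_prolongDomain hN).mem_nhds hq)).differentiableAt (by simp)).hasFDerivAt
  have h2 : HasFDerivAt φ.X _ (proj (by omega) q) := (φ.differentiableAt hq.1).hasFDerivAt.fst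
  have h3 := h2.comp q (hasFDerivAt_proj (by omega : 1 ≤ N) q)
  rw [h2.fderiv]
  exact h1.fst.unique h3

end ContactTransformation

lemma contactForm_totalField {k : ℕ} (i : Fin k) (q : Jet k) :
    contactForm k i q (totalField k q) = 0 := by
  simp [contactForm, dy, dx, totalField, shift_apply, Fin.succ]

/-- A combination of `dX` and `dx` is a combination of contact forms if and only if its horizontal
part vanishes. -/
lemma inContactSpan_iff {k : ℕ} (hk : 2 ≤ k) (q : Jet k) (A : Jet 1 →L[ℝ] ℝ) (g s : ℝ) :
    InContactSpan q (g • A.comp (projL (by omega : 1 ≤ k)) - s • dx k) ↔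
      g * A (1, fun i => (proj hk q).2 i.succ) = s := by
  have hproj : proj (by omega : 1 ≤ k) (totalField k q) = (1, fun i => (proj hk q).2 i.succ) :=
    proj_totalField hk q
  constructor
  · intro h
    -- Contact forms annihilate the total derivative field, so only the horizontal part is tested.
    have h0 : ∀ β ∈ Submodule.span ℝ (Set.range fun i : Fin k => contactForm k i q),
        β (totalField k q) = 0 := by
      intro β hβ
      induction hβ using Submodule.span_induction with
      | mem β hβ =>
        obtain ⟨i, rfl⟩ := hβ
        exact contactForm_totalField i q
      | zero => rfl
      | add β γ _ _ h1 h2 => rw [add_apply, h1, h2, add_zero]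
      | smul r β _ h1 => rw [smul_apply, h1, smul_zero]
    have := h0 _ h
    simp only [sub_apply, smul_apply,
      ContinuousLinearMap.comp_apply, projL_apply, hproj, smul_eq_mul] at this
    have hx : dx k (totalField k q) = 1 := by simp [dx, totalField, shift_apply]
    rw [hx] at this
    linarith
  · intro h
    have hmem : ∀ i : Fin k, contactForm k i q ∈
        Submodule.span ℝ (Set.range fun i : Fin k => contactForm k i q) := fun i =>
      Submodule.subset_span ⟨i, rfl⟩
    -- This is `dX = D X dx + X_{y_0} θ_0 + X_{y_1} θ_1`, multiplied by `g`.
    have key : g • A.comp (projL (by omega : 1 ≤ k)) - s • dx k =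
        (g * A (basisY 1 0)) • contactForm k ⟨0, by omega⟩ q +
          (g * A (basisY 1 1)) • contactForm k ⟨1, by omega⟩ q := by
      refine ContinuousLinearMap.ext fun v => ?_
      have hA : ∀ v : Jet 1, A v = v.1 * A (1, 0) + v.2 0 * A (basisY 1 0)
          + v.2 1 * A (basisY 1 1) := by
        intro v
        conv_lhs => rw [jet_eq_sum v]
        rw [Fin.sum_univ_two, map_add, map_add, map_smul, map_smul, map_smul]
        simp only [smul_eq_mul, Fin.val_zero, Fin.val_one]
        ring
      rw [hA] at h
      simp only [sub_apply, smul_apply,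
        add_apply, ContinuousLinearMap.comp_apply, projL_apply, smul_eq_mul]
      rw [hA (proj _ v)]
      simp only [contactForm, dy, dx, sub_apply,
        smul_apply, ContinuousLinearMap.comp_apply, smul_eq_mul,
        ContinuousLinearMap.coe_fst', ContinuousLinearMap.coe_snd',
        ContinuousLinearMap.proj_apply]
      simp only [proj] at h ⊢
      rw [← h]
      change g * (v.1 * A (1, 0) + v.2 ⟨0, _⟩ * A (basisY 1 0) + v.2 ⟨1, _⟩ * A (basisY 1 1)) -
        g * (1 * A (1, 0) + q.2 ⟨1, _⟩ * A (basisY 1 0) + q.2 ⟨2, _⟩ * A (basisY 1 1)) * v.1 =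
        g * A (basisY 1 0) * (v.2 ⟨0, _⟩ - q.2 ⟨1, _⟩ * v.1) +
        g * A (basisY 1 1) * (v.2 ⟨1, _⟩ - q.2 ⟨2, _⟩ * v.1)
      ring
    unfold InContactSpan
    rw [key]
    exact add_mem (Submodule.smul_mem _ _ (hmem _)) (Submodule.smul_mem _ _ (hmem _))

/-- The equivalence of Lagrangians in coordinates: `f₂(Φ) D X = α f₁ + D μ`. -/
lemma inContactSpan_pullback_iff {n m : ℕ} (φ : ContactTransformation) (L₁ L₂ : Lagrangian n)
    (hn : 2 ≤ n) (hm : n ≤ m) (α : ℝ) (μ : Jet m → ℝ) {q : Jet (m + 1)}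
    (hq : q ∈ φ.prolongDomain (by omega : 2 ≤ m + 1)) :
    InContactSpan q (pullback (φ.prolong (by omega : 1 ≤ m + 1)) (L₂.form (by omega : n ≤ m + 1)) q
        - (α • L₁.form (by omega : n ≤ m + 1) q + dH μ q)) ↔
      L₂.f (φ.prolong (by omega : 1 ≤ n) (proj (by omega : n ≤ m + 1) q)) *
          totalDeriv φ.X (proj (by omega : 1 + 1 ≤ m + 1) q) =
        α * L₁.f (proj (by omega : n ≤ m + 1) q) + totalDeriv μ q := by
  have h := inContactSpan_iff (by omega : 2 ≤ m + 1) q (fderiv ℝ φ.X (proj (by omega) q))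
    (L₂.f (φ.prolong (by omega : 1 ≤ n) (proj (by omega : n ≤ m + 1) q)))
    (α * L₁.f (proj (by omega : n ≤ m + 1) q) + totalDeriv μ q)
  rw [← ContactTransformation.dx_comp_fderiv_prolong (by omega : 2 ≤ m + 1) hq] at h
  convert h using 2
  · rw [pullback, Lagrangian.form, Lagrangian.form, dH, smul_smul, ← add_smul,
      ContinuousLinearMap.smul_comp]
    rfl
  · rfl

/-! ### Pull-backs of Lagrangians -/

section PullLagrangian

variable {n N : ℕ}

/-- The pull-back `f(Φ) D X` of a Lagrangian along the prolongation of a contact transformation: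
its value, its order, its Euler–Lagrange expression and the nondegeneracy of the latter. -/
lemma exists_pull_lagrangian (hn : 2 ≤ n) (hN : 2 * n ≤ N) (φ : ContactTransformation)
    (L : Lagrangian n) {U : Opens (Jet N)}
    (hU : (U : Set (Jet N)) ⊆ φ.prolongDomain (by omega : 2 ≤ N))
    (hL : ∀ p ∈ U, φ.prolong (by omega : 1 ≤ n) (proj (by omega : n ≤ N) p) ∈ L.dom) :
    ∃ G : smoothRing U, (∀ p : U, G p = L.f (φ.prolong (by omega : 1 ≤ n) (proj (by omega : n ≤ N) p)) *
        totalDeriv φ.X (proj (by omega : 2 ≤ N) p)) ∧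
      (jetCalc U).OrderLE n G ∧
      (∃ κ : smoothRing U, (∀ p, κ p ≠ 0) ∧ ∀ p : U, (jetCalc U).euler G p =
        κ p * L.eulerLagrange (φ.prolong (by omega : 1 ≤ 2 * n) (proj hN p))) ∧
      ∀ p : U, (jetCalc U).d (2 * n) ((jetCalc U).euler G) p ≠ 0 := by
  have hN2 : 2 ≤ N := by omega
  have hN1 : 1 ≤ N := by omega
  have hnN : n ≤ N := by omega
  have hUs : ∀ p ∈ U, proj hN1 p ∈ φ.toMap.source := fun p hp => (hU hp).1
  obtain ⟨w, hw⟩ := ContactTransformation.exists_inv_D_elemX hN2 hU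
  set U' : Opens (Jet N) := cylinder hnN L.isOpen_dom
  have hU' : ∀ p ∈ U, φ.prolong hN1 p ∈ U' := hL
  have hL' : ∀ p ∈ U', proj hnN p ∈ L.dom := fun p hp => hp
  set F := L.elem hnN hL'
  have hF : (jetCalc U').OrderLE n F := (L.represents_elem hnN hL').orderLE
  set X := ContactTransformation.elemX hN1 hUs
  have hX : Represents X hN1 φ.X := ContactTransformation.represents_X hN1 hUs
  set Y := ContactTransformation.elemY hN1 hUs
  have hY : ∀ i, (jetCalc U).OrderLE 1 (Y i) := fun i =>
    (ContactTransformation.represents_Y hN1 hUs i).orderLE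
  set c := (jetCalc U).vertCoeff w X (Y 0) 0 0
  have hc : ∀ p, c p ≠ 0 := ContactTransformation.vertCoeff_zero_zero_ne_zero hN1 hUs hw hN2
  have hcO : (jetCalc U).OrderLE 1 c := by
    rw [show c = _ from ContactTransformation.vertCoeff_zero_eq hN1 hUs hN2 hw 0]
    exact ((hY 0).d 0).sub ((hY 1).mul (hX.orderLE.d 0))
  have hwX : ∀ p, w p * (jetCalc U).D X p = 1 := fun p => by
    rw [← smoothRing.mul_apply, hw]
    rfl
  set P := ContactTransformation.pull hN1 hUs hw hN2 hU'
  have hE := ContactTransformation.euler_pull hN1 hUs hw hN2 hU' hF hN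
  have hDX : (jetCalc U).OrderLE 2 ((jetCalc U).D X) := hX.orderLE.D
  refine ⟨P F * (jetCalc U).D X, fun p => ?_, ?_, ⟨(jetCalc U).D X * c, fun p => ?_, fun p => ?_⟩,
    fun p => ?_⟩
  · rw [smoothRing.mul_apply, hX.D hN2 p]
    congr 1
    exact ContactTransformation.pull_apply hN1 hUs hw hN2 hU' F p
  · exact (ContactTransformation.orderLE_pull hN1 hUs hw hN2 hU' hF (by omega)).mul (hDX.mono hn)
  · rw [smoothRing.mul_apply]
    exact mul_ne_zero (right_ne_zero_of_mul_eq_one (hwX p)) (hc p)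
  · rw [hE, smoothRing.mul_apply, ContactTransformation.pull_apply,
      L.represents_euler hnN hN hL']
    rfl
  -- Nondegeneracy is read off the transformed Euler–Lagrange expression, whose factor `D X * c` has
  -- order `2 < 2n`. A direct computation of `∂_n ∂_n` of the Lagrangian would meet derivatives of
  -- `D X` when `n = 2`.
  · have hO : (jetCalc U).OrderLE 2 ((jetCalc U).D X * c) := hDX.mul (hcO.mono (by omega))
    rw [hE, Derivation.leibniz, hO (2 * n) (by omega) hN, smul_zero, add_zero, smul_eq_mul,
      ContactTransformation.d_top_pull hN1 hUs hw hN2 hU' (hF.euler hnN) (by omega) hN,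
      hF.d_top_euler hN]
    simp only [smoothRing.mul_apply, smoothRing.pow_apply, ContactTransformation.pull_apply]
    refine mul_ne_zero (mul_ne_zero (right_ne_zero_of_mul_eq_one (hwX p)) (hc p))
      (mul_ne_zero (mul_ne_zero (pow_ne_zero n (by simp)) (L.d_d_elem_ne_zero hnN hL' _))
        (mul_ne_zero (hc p) (pow_ne_zero _ (left_ne_zero_of_mul_eq_one (hwX p)))))

end PullLagrangian

/-! ### Equivalent Lagrangians have equivalent Euler–Lagrange equations -/

/-- Applying `E` to `f₂(Φ) D X = α f₁ + D μ` gives `κ · E(L₂)∘Φ = α E(L₁)` with `κ` and `α` nonzero.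
The cases `k = n` and `k = 2 * n` serve the two parts of the theorem. -/
lemma LagrangianEquivAt.exists_eulerLagrangeEquivAt {n k : ℕ} (hn : 2 ≤ n) (hk : n ≤ k)
    (hkn : k ≤ 2 * n) {L₁ L₂ : Lagrangian n} {a₁ a₂ : Jet k}
    (h : LagrangianEquivAt hn hk L₁ L₂ a₁ a₂) {b₁ : Jet (2 * n)} (hb : proj hkn b₁ = a₁) :
    ∃ b₂, proj hkn b₂ = a₂ ∧ (b₁ ∈ L₁.equation → b₂ ∈ L₂.equation) ∧
      EulerLagrangeEquivAt hn L₁ L₂ b₁ b₂ := by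
  obtain ⟨φ, V, hV, haV, hVd, hdom, ha, α, hα, m, hm, μ, hμ, hspan⟩ := h
  -- Large enough that `∂_N μ = 0`, so that `E(D μ) = 0` holds despite the truncation.
  obtain ⟨N, hNdef⟩ : ∃ N, N = m + 1 + 2 * n := ⟨_, rfl⟩
  have hN : 2 * n ≤ N := by omega
  have hkN : k ≤ N := by omega
  set U : Opens (Jet N) := cylinder hkN hV
  have hU : (U : Set (Jet N)) ⊆ φ.prolongDomain (by omega : 2 ≤ N) := fun p hp => hVd hp
  obtain ⟨G, hG, -, ⟨κ, hκ, hGE⟩, -⟩ := exists_pull_lagrangian hn hN φ L₂ hU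
    (fun p hp => (hdom _ hp).2)
  have hU1 : ∀ p ∈ U, proj (by omega : n ≤ N) p ∈ L₁.dom := fun p hp => (hdom _ hp).1
  set F := L₁.elem (by omega : n ≤ N) hU1
  set M : smoothRing U := smoothRing.mk (fun p => μ (proj (by omega : m ≤ N) p))
    (hμ.comp (contDiff_proj (by omega : m ≤ N)).contDiffOn fun p hp => hp)
  have hM : Represents M (by omega : m ≤ N) μ := fun _ => rfl
  have hGF : G = α • F + (jetCalc U).D M := by
    ext p
    rw [hG p, smoothRing.add_apply, smoothRing.smul_apply, hM.D (by omega : m + 1 ≤ N) p]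
    have hp : proj (by omega : k ≤ m + 1) (proj (by omega : m + 1 ≤ N) (p : Jet N)) ∈ V := p.2
    exact (inContactSpan_pullback_iff φ L₁ L₂ hn (by omega) α μ (hVd hp)).1 (hspan _ hp)
  have hEL : ∀ p : Jet (2 * n), proj hkn p ∈ V →
      (L₁.eulerLagrange p = 0 ↔ L₂.eulerLagrange (φ.prolong (by omega : 1 ≤ 2 * n) p) = 0) := by
    intro p hp
    -- Both expressions depend only on the `2n`-jet, so any extension of `p` to `J^N` would do.
    have hpU : extendBy (0 : Jet N) p ∈ U := by
      change proj hkn (proj hN (extendBy (0 : Jet N) p)) ∈ V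
      rwa [proj_extendBy]
    have h1 := hGE ⟨_, hpU⟩
    rw [hGF, JetCalc.euler_add, JetCalc.euler_smul,
      JetCalc.euler_D _ (hM.orderLE N (by omega) le_rfl), add_zero, smoothRing.smul_apply,
      L₁.represents_euler _ hN hU1] at h1
    simp only [proj_extendBy] at h1
    constructor
    · intro h
      rw [h, mul_zero] at h1
      exact (mul_eq_zero.1 h1.symm).resolve_left (hκ _)
    · intro h
      rw [h, mul_zero] at h1
      exact (mul_eq_zero.1 h1).resolve_left hα
  have h2 : ∀ p : Jet (2 * n), proj hkn p ∈ V → p ∈ L₁.equation →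
      φ.prolong (by omega : 1 ≤ 2 * n) p ∈ L₂.equation := fun p hp hpE =>
    ⟨(hdom _ hp).2, (hEL p hp).1 hpE.2⟩
  refine ⟨φ.prolong (by omega) b₁, ?_, h2 b₁ (by rwa [hb]), φ, {p | proj hkn p ∈ V},
    hV.preimage (continuous_proj hkn), ?_, fun p hp => hVd hp, rfl, ?_⟩
  · rw [← ha, ← hb]
    rfl
  · change proj hkn b₁ ∈ V
    rwa [hb]
  · ext q
    constructor
    · rintro ⟨p, ⟨hpE, hpV⟩, rfl⟩
      exact ⟨h2 p hpV hpE, p, hpV, rfl⟩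
    · rintro ⟨hq, p, hpV, rfl⟩
      exact ⟨p, ⟨⟨(hdom _ hpV).1, (hEL p hpV).2 hq.2⟩, hpV⟩, rfl⟩

/-! ### Equivalent Euler–Lagrange equations come from equivalent Lagrangians -/

section Restriction

variable {N : ℕ} {U V : Opens (Jet N)}

/-- The restriction of smooth functions to a smaller open set. -/
def smoothRing.res (h : V ≤ U) (F : smoothRing U) : smoothRing V :=
  smoothRing.mk (smoothRing.toFun F) ((smoothRing.contDiffOn_toFun F).mono h)

namespace smoothRing

variable (h : V ≤ U)

lemma res_apply (F : smoothRing U) (p : V) : res h F p = F ⟨p, h p.2⟩ :=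
  toFun_of_mem F (h p.2)

lemma res_D (F : smoothRing U) : res h ((jetCalc U).D F) = (jetCalc V).D (res h F) := by
  ext p
  rw [res_apply, D_apply (res h F) (G := toFun F) (fun _ => rfl),
    D_apply F (fun q => (toFun_apply F q).symm)]

lemma res_d (i : ℕ) (F : smoothRing U) : res h ((jetCalc U).d i F) = (jetCalc V).d i (res h F) := by
  ext p
  rw [res_apply, d_apply (res h F) (G := toFun F) (fun _ => rfl),
    d_apply F (fun q => (toFun_apply F q).symm)]

lemma res_iterate_D (j : ℕ) (F : smoothRing U) :
    res h ((jetCalc U).D^[j] F) = (jetCalc V).D^[j] (res h F) := by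
  induction j with
  | zero => rfl
  | succ j ih => rw [Function.iterate_succ_apply', Function.iterate_succ_apply', res_D, ih]

lemma res_mul (F G : smoothRing U) : res h (F * G) = res h F * res h G := by
  ext p
  simp only [res_apply, mul_apply]

lemma res_euler (F : smoothRing U) : res h ((jetCalc U).euler F) = (jetCalc V).euler (res h F) := by
  ext p
  rw [res_apply, JetCalc.euler, JetCalc.euler, JetCalc.altSum, JetCalc.altSum, sum_apply, sum_apply]
  refine Finset.sum_congr rfl fun j _ => ?_
  rw [mul_apply, mul_apply, ← res_d, ← res_iterate_D, res_apply]
  rfl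

lemma res_orderLE {k : ℕ} {F : smoothRing U} (hF : (jetCalc U).OrderLE k F) :
    (jetCalc V).OrderLE k (res h F) := by
  intro i hi hN
  rw [← res_d, hF i hi hN]
  ext p
  rw [res_apply]
  rfl

end smoothRing

end Restriction

/-! #### The multiplier is constant -/

lemma norm_basisY_le {N i : ℕ} : ‖basisY N i‖ ≤ 1 := by
  refine max_le (by simp [basisY]) ((pi_norm_le_iff_of_nonneg zero_le_one).2 fun j => ?_)
  simp only [basisY]
  split_ifs <;> simp

/-- Filling in the coordinates of the centre costs nothing in the sup distance, so a ball in `J^k`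
lifts into the ball of the same radius in `J^N`. -/
lemma dist_extendBy_le {k N : ℕ} (h : k ≤ N) (p : Jet N) (q : Jet k) :
    dist (extendBy p q) p ≤ dist q (proj h p) := by
  rw [Prod.dist_eq, max_le_iff]
  refine ⟨le_max_left _ _, (dist_pi_le_iff dist_nonneg).2 fun j => ?_⟩
  by_cases hj : (j : ℕ) < k + 1
  · simp only [extendBy, hj, dite_true]
    exact (dist_le_pi_dist q.2 (proj h p).2 ⟨j, hj⟩).trans (le_max_right _ _)
  · simp only [extendBy, hj, dite_false, dist_self]
    exact dist_nonneg

/-- If `f` is affine in `y_i` with simple zeros and `H` does not depend on `y_i`, then `H` vanishes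
near a zero of `f` as soon as it vanishes on the zeros of `f`. -/
lemma exists_ball_eq_zero {N i : ℕ} {U : Opens (Jet N)} {b : Jet N} (hbU : b ∈ U)
    {f H δ : smoothRing U} (hddf : (jetCalc U).d i ((jetCalc U).d i f) = 0)
    (hδf : δ * (jetCalc U).d i f = f) (hδb : δ ⟨b, hbU⟩ = 0) (hdH : (jetCalc U).d i H = 0)
    (hfH : ∀ p, f p = 0 → H p = 0) :
    ∃ r, 0 < r ∧ Metric.ball b r ⊆ U ∧ ∀ p : U, dist (p : Jet N) b < r → H p = 0 := by
  obtain ⟨r₁, hr₁, hball⟩ := Metric.isOpen_iff.1 U.isOpen b hbU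
  have hδc : ContinuousAt (smoothRing.toFun δ) b :=
    ((smoothRing.contDiffOn_toFun δ).continuousOn).continuousAt (U.isOpen.mem_nhds hbU)
  -- Half of `r₁` is reserved for the displacement `δ`, the other half for the distance from `p` to
  -- `b`.
  obtain ⟨r', hr', hδr⟩ := Metric.continuousAt_iff.1 hδc (r₁ / 2) (by linarith)
  refine ⟨min r' (r₁ / 2), lt_min hr' (by linarith), (Metric.ball_subset_ball
    ((min_le_right _ _).trans (by linarith))).trans hball, fun p hp => ?_⟩
  obtain ⟨p, hpU⟩ := p
  have hs : |δ ⟨p, hpU⟩| < r₁ / 2 := by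
    have := hδr (lt_min_iff.1 hp).1
    rwa [smoothRing.toFun_of_mem δ hbU, hδb, smoothRing.toFun_of_mem δ hpU, Real.dist_eq,
      sub_zero] at this
  -- As `δ` plays the role of `f / ∂_i f` and `f` is affine in `y_i`, moving `p` by `-δ(p)` lands on
  -- a zero of `f`; `H` does not change on the way.
  obtain ⟨s, hs_def⟩ : ∃ s, s = -δ ⟨p, hpU⟩ := ⟨_, rfl⟩
  have hseg : ∀ t ∈ Set.Icc (0 : ℝ) 1, p + (t * s) • basisY N i ∈ U := by
    intro t ht
    refine hball (Metric.mem_ball.2 ?_)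
    have h1 : dist (p + (t * s) • basisY N i) p ≤ |s| := by
      rw [dist_eq_norm, add_sub_cancel_left, norm_smul, Real.norm_eq_abs, abs_mul,
        abs_of_nonneg ht.1]
      calc t * |s| * ‖basisY N i‖ ≤ 1 * |s| * 1 := by
            gcongr
            · exact ht.2
            · exact norm_basisY_le
        _ = |s| := by ring
    rw [hs_def, abs_neg, ← hs_def] at h1
    have := dist_triangle (p + (t * s) • basisY N i) p b
    have := (lt_min_iff.1 hp).2
    linarith
  have hqU : p + s • basisY N i ∈ U := by simpa using hseg 1 (by simp)
  have kf := smoothRing.toFun_add_smul_basisY hddf p s hseg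
  have kH := smoothRing.toFun_add_smul_basisY (F := H) (by rw [hdH, map_zero]) p s hseg
  have hfq : f ⟨_, hqU⟩ = 0 := by
    rw [smoothRing.toFun_of_mem _ hqU, smoothRing.toFun_of_mem _ hpU,
      smoothRing.toFun_of_mem _ hpU] at kf
    have := congrArg (fun f : smoothRing U => f ⟨p, hpU⟩) hδf
    simp only [smoothRing.mul_apply] at this
    rw [kf, hs_def]
    linarith
  rw [smoothRing.toFun_of_mem _ hqU, hfH _ hfq, hdH, smoothRing.toFun_of_mem _ hpU,
    smoothRing.toFun_of_mem _ hpU, smoothRing.zero_apply, mul_zero, add_zero] at kH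
  exact kH.symm

/-! ### Leading coefficients and the multiplier -/

namespace JetCalc

variable {R : Type*} [CommRing R] [Algebra ℝ R] {n N : ℕ} {C : JetCalc R N} {F G u : R}

lemma OrderLE.of_mul_eq_one {a : R} (ha : C.OrderLE n a) (hu : u * a = 1) : C.OrderLE n u := by
  intro i hi hiN
  have := congrArg (C.d i) hu
  rw [Derivation.leibniz, ha i hi hiN, Derivation.map_one_eq_zero, smul_zero,
    zero_add, smul_eq_mul] at this
  linear_combination u * this - C.d i u * hu

lemma d_d_top_euler (hn : 1 ≤ n) (hN : 2 * n ≤ N) (hF : C.OrderLE n F) :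
    C.d (2 * n) (C.d (2 * n) (C.euler F)) = 0 := by
  rw [hF.d_top_euler hN, d_neg_one_pow_mul, ((hF.d n).d n) _ (by omega) (by omega), mul_zero]

/-- Supplies the quotient `δ` of `E(F)` by its `y_{2n}`-derivative for `exists_ball_eq_zero`; it
vanishes wherever `E(F)` does. -/
lemma euler_eq_mul_d_top_euler (hN : 2 * n ≤ N) (hF : C.OrderLE n F)
    (hu : u * C.d n (C.d n F) = 1) :
    (-1) ^ n * u * C.euler F * C.d (2 * n) (C.euler F) = C.euler F := by
  have h1 : ((-1) ^ n * (-1) ^ n : R) = 1 := by rw [← pow_add, Even.neg_one_pow ⟨n, rfl⟩]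
  rw [hF.d_top_euler hN]
  linear_combination (C.euler F * u * C.d n (C.d n F)) * h1 + C.euler F * hu

lemma d_top_euler_sub_multiplier (hn : 1 ≤ n) (hN : 2 * n ≤ N) (hF : C.OrderLE n F)
    (hG : C.OrderLE n G) (hu : u * C.d n (C.d n F) = 1) :
    C.d (2 * n) (C.euler G - u * C.d n (C.d n G) * C.euler F) = 0 := by
  have hl : C.OrderLE n (u * C.d n (C.d n G)) :=
    (OrderLE.of_mul_eq_one ((hF.d n).d n) hu).mul ((hG.d n).d n)
  rw [map_sub, Derivation.leibniz, hl _ (by omega) (by omega), hF.d_top_euler hN,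
    hG.d_top_euler hN]
  simp only [smul_eq_mul]
  linear_combination (-(-1) ^ n * C.d n (C.d n G)) * hu

end JetCalc

/-- If the Euler–Lagrange expression of `G` vanishes on the Euler–Lagrange equation of `F`, then
near a given point of the latter it is a multiple of that of `F` by a function of order `n`. -/
lemma exists_multiplier {n N : ℕ} (hn : 1 ≤ n) (hN : 2 * n ≤ N) {U : Opens (Jet N)} {b : Jet N}
    (hbU : b ∈ U) {F G u : smoothRing U}
    (hF : (jetCalc U).OrderLE n F) (hG : (jetCalc U).OrderLE n G)
    (hu : u * (jetCalc U).d n ((jetCalc U).d n F) = 1) (hb : (jetCalc U).euler F ⟨b, hbU⟩ = 0)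
    (hFG : ∀ p, (jetCalc U).euler F p = 0 → (jetCalc U).euler G p = 0) :
    ∃ r, 0 < r ∧ Metric.ball b r ⊆ U ∧ ∀ p : U, dist (p : Jet N) b < r →
      (jetCalc U).euler G p =
        (u * (jetCalc U).d n ((jetCalc U).d n G) * (jetCalc U).euler F) p := by
  obtain ⟨r, hr, hrU, h⟩ := exists_ball_eq_zero hbU (JetCalc.d_d_top_euler hn hN hF)
    (JetCalc.euler_eq_mul_d_top_euler hN hF hu) (by rw [smoothRing.mul_apply, hb, mul_zero])
    (JetCalc.d_top_euler_sub_multiplier hn hN hF hG hu)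
    (fun p hp => by
      rw [smoothRing.sub_apply, smoothRing.mul_apply, hp, hFG p hp, mul_zero, sub_zero])
  exact ⟨r, hr, hrU, fun p hp => sub_eq_zero.1 (h p hp)⟩

/-- Two Lagrangians of order `n ≥ 2` with the same Euler–Lagrange equation agree up to a constant
factor and a total derivative. -/
theorem exists_smul_add_D {n N : ℕ} (hn : 2 ≤ n) (hN : 2 * n ≤ N) {U : Opens (Jet N)} {b : Jet N}
    (hbU : b ∈ U) {F G : smoothRing U}
    (hF : (jetCalc U).OrderLE n F) (hG : (jetCalc U).OrderLE n G)
    (hF0 : ∀ p, (jetCalc U).d n ((jetCalc U).d n F) p ≠ 0)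
    (hG0 : ∀ p, (jetCalc U).d (2 * n) ((jetCalc U).euler G) p ≠ 0)
    (hb : (jetCalc U).euler F ⟨b, hbU⟩ = 0)
    (hFG : ∀ p, (jetCalc U).euler F p = 0 → (jetCalc U).euler G p = 0) :
    ∃ r, 0 < r ∧ ∃ V : Opens (Jet N), (V : Set (Jet N)) = Metric.ball b r ∧ ∃ hVU : V ≤ U,
      ∃ α : ℝ, α ≠ 0 ∧ ∃ μ : smoothRing V, (∀ i, n ≤ i → i ≤ N → (jetCalc V).d i μ = 0) ∧
        ∀ p : V, G ⟨p, hVU p.2⟩ = α * F ⟨p, hVU p.2⟩ + (jetCalc V).D μ p := by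
  obtain ⟨u, hu⟩ := smoothRing.exists_inv _ hF0
  obtain ⟨r, hr0, hrU, hl⟩ := exists_multiplier (by omega) hN hbU hF hG hu hb hFG
  obtain ⟨V, hV⟩ : ∃ V : Opens (Jet N), (V : Set (Jet N)) = Metric.ball b r :=
    ⟨⟨_, Metric.isOpen_ball⟩, rfl⟩
  have hVU : V ≤ U := fun p hp => hrU (hV.subset hp)
  -- Convexity is needed twice: for the constancy of the multiplier and for the Poincaré lemma.
  have hconv : Convex ℝ (V : Set (Jet N)) := hV ▸ convex_ball b r
  have hbV : b ∈ V := hV.symm.subset (Metric.mem_ball_self hr0)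
  have hG0b : (jetCalc U).d n ((jetCalc U).d n G) ⟨b, hbU⟩ ≠ 0 := by
    have := hG0 ⟨b, hbU⟩
    rw [hG.d_top_euler hN] at this
    exact right_ne_zero_of_mul this
  have hub : u ⟨b, hbU⟩ ≠ 0 := by
    have := congrArg (fun f : smoothRing U => f ⟨b, hbU⟩) hu
    exact left_ne_zero_of_mul_eq_one this
  set F' := smoothRing.res hVU F
  set G' := smoothRing.res hVU G
  have hF' : (jetCalc V).OrderLE n F' := smoothRing.res_orderLE hVU hF
  have hG' : (jetCalc V).OrderLE n G' := smoothRing.res_orderLE hVU hG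
  set u' := smoothRing.res hVU u
  have hu' : u' * (jetCalc V).d n ((jetCalc V).d n F') = 1 := by
    rw [← smoothRing.res_d, ← smoothRing.res_d, ← smoothRing.res_mul, hu]
    ext p
    rw [smoothRing.res_apply]
    rfl
  set l := u' * (jetCalc V).d n ((jetCalc V).d n G') with hldef
  have hlU : l = smoothRing.res hVU (u * (jetCalc U).d n ((jetCalc U).d n G)) := by
    rw [smoothRing.res_mul, smoothRing.res_d, smoothRing.res_d]
  have hEl : (jetCalc V).euler G' = l * (jetCalc V).euler F' := by
    rw [← smoothRing.res_euler, ← smoothRing.res_euler, hlU, ← smoothRing.res_mul]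
    ext p
    rw [smoothRing.res_apply, smoothRing.res_apply]
    exact hl ⟨p, hVU p.2⟩ (hV.subset p.2)
  have hOu : (jetCalc V).OrderLE n u' := JetCalc.OrderLE.of_mul_eq_one ((hF'.d n).d n) hu'
  have hOl : (jetCalc V).OrderLE n l := hOu.mul ((hG'.d n).d n)
  have hDl : (jetCalc V).D l = 0 := JetCalc.D_multiplier_eq_zero hn hN hF' hG' hOl hu'
    (by linear_combination (-(jetCalc V).d n ((jetCalc V).d n G')) * hu') hEl
  have hconst := eq_of_D_eq_zero hconv hDl (hOl.d_eq_zero_of_D_eq_zero (by omega) hDl)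
  set α := l ⟨b, hbV⟩ with hα
  have hlα : ∀ f : smoothRing V, l * f = α • f := by
    intro f
    ext p
    rw [smoothRing.mul_apply, smoothRing.smul_apply, hα, hconst p ⟨b, hbV⟩]
  obtain ⟨μ, hμ, hDμ⟩ := exists_D_eq_of_euler_eq_zero hconv (by omega) hN
    (hG'.sub (hF'.smul α)) (by
      rw [JetCalc.euler_sub, JetCalc.euler_smul, hEl, hlα, sub_self])
  refine ⟨r, hr0, V, hV, hVU, α, ?_, μ, hμ, fun p => ?_⟩
  · rw [hα, hlU, smoothRing.res_apply, smoothRing.mul_apply]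
    exact mul_ne_zero hub hG0b
  · have := congrArg (fun f : smoothRing V => f p) hDμ
    simp only [smoothRing.sub_apply, smoothRing.smul_apply, F', G', smoothRing.res_apply] at this
    linarith

/-! #### From Euler–Lagrange equations to Lagrangians -/

/-- The total derivative of the restriction of `μ` to `J^k` when `μ` has order less than `k`. -/
lemma totalDeriv_comp_extendBy {k N : ℕ} (hkN : k ≤ N) {U : Opens (Jet N)} (μ : smoothRing U)
    (hμ : ∀ i, k ≤ i → i ≤ N → (jetCalc U).d i μ = 0) (b : Jet N) {q : Jet (k + 1)}
    (hq : extendBy b (proj k.le_succ q) ∈ U) :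
    totalDeriv (fun q : Jet k => smoothRing.toFun μ (extendBy b q)) q =
      (jetCalc U).D μ ⟨_, hq⟩ := by
  have h1 := (smoothRing.differentiableAt (smoothRing.contDiffOn_toFun μ) ⟨_, hq⟩).hasFDerivAt
  have h2 := h1.comp (proj k.le_succ q) (hasFDerivAt_extendBy b (proj k.le_succ q))
  rw [totalDeriv, show fderiv ℝ (fun q : Jet k => smoothRing.toFun μ (extendBy b q)) _ = _ from
    h2.fderiv, D_apply μ (fun p => (smoothRing.toFun_apply μ p).symm),
    ContinuousLinearMap.comp_apply,
    fderiv_apply_eq_sum μ (fun p => (smoothRing.toFun_apply μ p).symm),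
    fderiv_apply_eq_sum μ (fun p => (smoothRing.toFun_apply μ p).symm)]
  refine congrArg₂ _ (by simp [totalField, shift_apply, extendL_apply, extendBy])
    (Finset.sum_congr rfl fun i _ => ?_)
  by_cases hi : (i : ℕ) < k
  · congr 1
    have h3 : (i : ℕ) ≤ k := hi.le
    have h4 : (i : ℕ) < N := by omega
    simp [totalField, shift_apply, extendL_apply, extendBy, h3, h4, hi, proj, Fin.succ]
  · rw [hμ i (by omega) (by omega)]
    simp

/-- It is enough that `Φ` maps `ℰ(L₁)` into `ℰ(L₂)` near `b₁`. The resulting `μ` lives on a ball in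
`J^{2n}` but does not depend on `y_i` for `i ≥ n`; freezing the coordinates above `k` at those of
`b₁` therefore yields a function on `J^k` with the same total derivative. -/
lemma EulerLagrangeEquivAt.lagrangianEquivAt {n k : ℕ} (hn : 2 ≤ n) (hk : n ≤ k)
    (hkn : k ≤ 2 * n) {L₁ L₂ : Lagrangian n} {b₁ b₂ : Jet (2 * n)} (hb₁ : b₁ ∈ L₁.equation)
    (h : EulerLagrangeEquivAt hn L₁ L₂ b₁ b₂) :
    LagrangianEquivAt hn hk L₁ L₂ (proj hkn b₁) (proj hkn b₂) := by
  obtain ⟨φ, V, hV, hbV, hVd, hφb, himage⟩ := h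
  have hmaps : ∀ p ∈ V, p ∈ L₁.equation → φ.prolong (by omega : 1 ≤ 2 * n) p ∈ L₂.equation :=
    fun p hp hpE => (himage.subset ⟨p, ⟨hpE, hp⟩, rfl⟩).1
  have hnN : n ≤ 2 * n := by omega
  have hcont : ContinuousAt (φ.prolong (by omega : 1 ≤ 2 * n)) b₁ :=
    (ContactTransformation.contDiffOn_prolong_of_subset (U := ⟨V, hV⟩) (by omega)
      hVd).continuousOn.continuousAt (hV.mem_nhds hbV)
  have hnear : ∀ᶠ p in 𝓝 b₁, p ∈ V ∧ proj hnN p ∈ L₁.dom ∧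
      proj hnN (φ.prolong (by omega : 1 ≤ 2 * n) p) ∈ L₂.dom := by
    filter_upwards [hV.mem_nhds hbV,
      (continuous_proj hnN).continuousAt.eventually_mem (L₁.isOpen_dom.mem_nhds hb₁.1),
      ((continuous_proj hnN).continuousAt.comp hcont).eventually_mem
        (L₂.isOpen_dom.mem_nhds (hmaps b₁ hbV hb₁).1)] with p h1 h2 h3 using ⟨h1, h2, h3⟩
  obtain ⟨r₁, hr₁, hball⟩ := Metric.eventually_nhds_iff_ball.1 hnear
  obtain ⟨U, hU⟩ : ∃ U : Opens (Jet (2 * n)), (U : Set _) = Metric.ball b₁ r₁ :=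
    ⟨⟨_, Metric.isOpen_ball⟩, rfl⟩
  replace hball := fun p (hp : p ∈ U) => hball p (hU.subset hp)
  have hU1 : ∀ p ∈ U, proj hnN p ∈ L₁.dom := fun p hp => (hball p hp).2.1
  obtain ⟨G, hG, hGO, ⟨κ, -, hGE⟩, hG0⟩ := exists_pull_lagrangian hn le_rfl φ L₂
    (U := U) (fun p hp => hVd (hball p hp).1) (fun p hp => (hball p hp).2.2)
  have hF := L₁.represents_elem hnN hU1
  have hFE := L₁.represents_euler hnN le_rfl hU1
  obtain ⟨r, hr0, W, hW, hWU, α, hα, μ, hμ, hGF⟩ := exists_smul_add_D hn le_rfl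
    (hU.symm.subset (Metric.mem_ball_self hr₁)) hF.orderLE hGO
    (L₁.d_d_elem_ne_zero hnN hU1) hG0 ((hFE _).trans hb₁.2) (fun p hp => by
      rw [hGE p]
      have := (hmaps p (hball p p.2).1 ⟨hU1 p p.2, (hFE p).symm.trans hp⟩).2
      rw [proj_self, this, mul_zero])
  have hext : ∀ q ∈ Metric.ball (proj hkn b₁) r, extendBy b₁ q ∈ W := fun q hq =>
    hW.symm.subset ((dist_extendBy_le hkn b₁ q).trans_lt hq)
  have hdom : Metric.ball (proj hkn b₁) r ⊆ φ.prolongDomain (by omega : 2 ≤ k) := by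
    intro q hq
    have := hVd (hball _ (hWU (hext q hq))).1
    rw [← proj_extendBy hkn b₁ q]
    exact this
  refine ⟨φ, Metric.ball (proj hkn b₁) r, Metric.isOpen_ball, Metric.mem_ball_self hr0, hdom,
    fun q hq => ?_, ?_, α, hα, k, le_rfl, fun q => smoothRing.toFun μ (extendBy b₁ q), ?_,
    fun q hq => ?_⟩
  · have := (hball _ (hWU (hext q hq))).2
    rw [← proj_extendBy hkn b₁ q]
    exact this
  · rw [← hφb]
    rfl
  · exact (smoothRing.contDiffOn_toFun μ).comp (contDiff_extendBy b₁).contDiffOn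
      fun q hq => hext q hq
  · have hqd : q ∈ φ.prolongDomain (by omega : 2 ≤ k + 1) := hdom hq
    refine (inContactSpan_pullback_iff φ L₁ L₂ hn hk α _ hqd).2 ?_
    rw [totalDeriv_comp_extendBy hkn μ (fun i hi => hμ i (by omega)) b₁ (hext _ hq)]
    have h1 := hGF ⟨_, hext _ hq⟩
    rw [hG, hF] at h1
    have hp : proj hkn (extendBy b₁ (proj k.le_succ q)) = proj k.le_succ q := proj_extendBy _ _ _
    have hpn : proj hnN (extendBy b₁ (proj k.le_succ q)) = proj (by omega : n ≤ k + 1) q := by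
      rw [← proj_proj hk hkn, hp]
      rfl
    have hp2 : proj (by omega : 2 ≤ 2 * n) (extendBy b₁ (proj k.le_succ q)) =
        proj (by omega : 2 ≤ k + 1) q := by
      rw [← proj_proj (by omega : 2 ≤ k) hkn, hp]
      rfl
    simp only [hpn, hp2] at h1
    exact h1

end VarJet

end

theorem mainTheorem5 (n : ℕ) (hn : 2 ≤ n) (L₁ L₂ : VarJet.Lagrangian n) :
    (∀ a₁ a₂ : VarJet.Jet n,
      VarJet.LagrangianEquivAt hn (le_refl n) L₁ L₂ a₁ a₂ ↔
        ∃ b₁ ∈ L₁.equation, ∃ b₂ ∈ L₂.equation,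
          VarJet.proj (by omega : n ≤ 2 * n) b₁ = a₁ ∧
          VarJet.proj (by omega : n ≤ 2 * n) b₂ = a₂ ∧
          VarJet.EulerLagrangeEquivAt hn L₁ L₂ b₁ b₂) ∧
    (∀ b₁ ∈ L₁.equation, ∀ b₂ : VarJet.Jet (2 * n),
      VarJet.LagrangianEquivAt hn (by omega : n ≤ 2 * n) L₁ L₂ b₁ b₂ ↔
        VarJet.EulerLagrangeEquivAt hn L₁ L₂ b₁ b₂) := by
  refine ⟨fun a₁ a₂ => ⟨fun h => ?_, ?_⟩, fun b₁ hb₁ b₂ => ⟨fun h => ?_, fun h => ?_⟩⟩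
  · have ha₁ : a₁ ∈ L₁.dom := by
      obtain ⟨φ, V, -, haV, -, hdom, -⟩ := h
      exact (hdom a₁ haV).1
    -- Only `n`-jets are given; a point of the equation over `a₁` exists because the equation can be
    -- solved for `y_{2n}`.
    obtain ⟨b₁, hb₁, hba⟩ := L₁.exists_mem_equation (by omega) ha₁
    obtain ⟨b₂, hba₂, hb₂, hE⟩ := h.exists_eulerLagrangeEquivAt hn le_rfl (by omega) hba
    exact ⟨b₁, hb₁, b₂, hb₂ hb₁, hba, hba₂, hE⟩
  · rintro ⟨b₁, hb₁, b₂, -, rfl, rfl, hE⟩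
    exact hE.lagrangianEquivAt hn le_rfl (by omega) hb₁
  · obtain ⟨b₂', rfl, -, hE⟩ := h.exists_eulerLagrangeEquivAt hn _ le_rfl (b₁ := b₁) rfl
    exact hE
  · exact h.lagrangianEquivAt hn _ le_rfl hb₁
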